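/- Let $d\ge 4$ be even, let $\Omega_d=\begin{pmatrix}0&I_{d/2}\\-I_{d/2}&0\end{pmatrix}$ and let $Sp(d)=\{S\in U(d): S^{\top}\Omega_d S=\Omega_d\}$ be the compact symplectic group. A linear map $\mathcal L:M_d(\mathbb C)\to M_d(\mathbb C)$ is called $(S,S)$-covariant if $\mathcal L(SZS^*)=S\mathcal L(Z)S^*$, and $(S,\overline S)$-covariant if $\mathcal L(SZS^*)=\overline S\,\mathcal L(Z)\,\overline S^{\,*}$, for all $S\in Sp(d)$ and $Z\in M_d(\mathbb C)$, where $\overline S$ is the entrywise complex conjugate. It is Hermitian-preserving if $\mathcal L(Z^*)=\mathcal L(Z)^*$ for all $Z$, and positive if it maps positive semidefinite matrices to positive semidefinite matrices. It is completely positive (CP) if $\mathrm{id}_k\otimes\mathcal L$ is positive for all $k\ge1$, completely copositive if $\top\circ\mathcal L$ is CP, where $\top$ is the transposition $Z\mapsto Z^{\top}$, and decomposable if it is the sum of a CP and a completely copositive map. Its Choi matrix is $C_{\mathcal L}=\frac1d\sum_{i,j=1}^d|i\rangle\langle j|\otimes\mathcal L(|i\rangle\langle j|)$. The map $\mathcal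 L$ is PPT if it is CP and $(\mathrm{id}\otimes\top)(C_{\mathcal L})\ge0$. It is entanglement breaking if $C_{\mathcal L}$ is separable, i.e. a nonnegative multiple of a convex combination of projections $|v\otimes w\rangle\langle v\otimes w|$ with unit vectors $v,w\in\mathbb C^d$. Let $\mathcal L_1,\mathcal L_2:M_d(\mathbb C)\to M_d(\mathbb C)$ be Hermitian-preserving linear maps, each of which is $(S,S)$-covariant or $(S,\overline S)$-covariant. 1. If $\mathcal L_1$ and $\mathcal L_2$ are both PPT, then $\mathcal L_1\circ\mathcal L_2$ is entanglement breaking. 2. If $\mathcal L_1$ is positive and $\mathcal L_2$ is PPT, then both compositions $\mathcal L_1\circ\mathcal L_2$ and $\mathcal L_2\circ\mathcal L_1$ are decomposable. -/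

import Mathlib

open scoped Matrix Kronecker ComplexOrder

noncomputable section

namespace SympPPT

variable {α β κ : Type*} [Fintype α] [DecidableEq α] [Fintype β] [DecidableEq β]

/-- The complex matrix algebra with rows and columns indexed by `α`. -/
abbrev Mat (α : Type*) : Type _ := Matrix α α ℂ

/-- The transposition map `Z ↦ Zᵀ`. -/
def transp (α : Type*) : Mat α →ₗ[ℂ] Mat α :=
  (Matrix.transposeLinearEquiv α α ℂ ℂ).toLinearMap

/-- `(id ⊗ L)(X)`: the map `L` is applied to every block of `X`. Here `M_κ ⊗ M_α` is identified with
the matrices indexed by `κ × α`. -/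
def ampliation (κ : Type*) (L : Mat α →ₗ[ℂ] Mat β) (X : Mat (κ × α)) : Mat (κ × β) :=
  Matrix.of fun p q => L (Matrix.of fun a b => X (p.1, a) (q.1, b)) p.2 q.2

/-- Hermitian-preserving maps (commuting with the conjugate transpose). -/
def IsHermitianPreserving (L : Mat α →ₗ[ℂ] Mat β) : Prop :=
  ∀ Z : Mat α, L Zᴴ = (L Z)ᴴ

/-- Positive maps. -/
def IsPositiveMap (L : Mat α →ₗ[ℂ] Mat β) : Prop :=
  ∀ Z : Mat α, Z.PosSemidef → (L Z).PosSemidef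

/-- `k`-positive maps: `id_k ⊗ L` is positive. -/
def IsKPositive (k : ℕ) (L : Mat α →ₗ[ℂ] Mat β) : Prop :=
  ∀ X : Mat (Fin k × α), X.PosSemidef → (ampliation (Fin k) L X).PosSemidef

/-- Completely positive maps. -/
def IsCP (L : Mat α →ₗ[ℂ] Mat β) : Prop :=
  ∀ k : ℕ, 1 ≤ k → IsKPositive k L

/-- Completely copositive maps: `⊤ ∘ L` is completely positive. -/
def IsCoCP (L : Mat α →ₗ[ℂ] Mat β) : Prop :=
  IsCP (transp β ∘ₗ L)

/-- Decomposable maps: sums of a completely positive and a completely copositive map. -/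
def IsDecomposable (L : Mat α →ₗ[ℂ] Mat β) : Prop :=
  ∃ L₁ L₂ : Mat α →ₗ[ℂ] Mat β, IsCP L₁ ∧ IsCoCP L₂ ∧ L = L₁ + L₂

/-- The normalized Choi matrix `C_L = (1/d) ∑ᵢⱼ |i⟩⟨j| ⊗ L(|i⟩⟨j|)`, `d` the size of `α`. -/
def choi (L : Mat α →ₗ[ℂ] Mat β) : Mat (α × β) :=
  (1 / (Fintype.card α : ℂ)) •
    ∑ i : α, ∑ j : α, Matrix.single i j (1 : ℂ) ⊗ₖ L (Matrix.single i j (1 : ℂ))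

/-- The partial transpose `X ↦ (id ⊗ ⊤)(X)`. -/
def partialTranspose (X : Mat (α × β)) : Mat (α × β) :=
  ampliation α (transp β) X

/-- PPT maps: completely positive maps whose Choi matrix has a positive partial transpose. -/
def IsPPTMap (L : Mat α →ₗ[ℂ] Mat β) : Prop :=
  IsCP L ∧ (partialTranspose (choi L)).PosSemidef

/-- The rank-one projections `|v ⊗ w⟩⟨v ⊗ w|` onto product vectors, with `v` and `w` unit vectors. -/
def productStates (α β : Type*) [Fintype α] [Fintype β] : Set (Mat (α × β)) :=
  {ρ | ∃ (v : α → ℂ) (w : β → ℂ), star v ⬝ᵥ v = 1 ∧ star w ⬝ᵥ w = 1 ∧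
    ρ = Matrix.vecMulVec (fun p : α × β => v p.1 * w p.2)
          (star fun p : α × β => v p.1 * w p.2)}

/-- The separable states: the convex hull of the pure product states. -/
def separableStates (α β : Type*) [Fintype α] [Fintype β] : Set (Mat (α × β)) :=
  convexHull ℝ (productStates α β)

/-- Separable matrices of arbitrary trace: nonnegative multiples of separable states. -/
def IsSeparable (X : Mat (α × β)) : Prop :=
  ∃ (c : ℝ) (ρ : Mat (α × β)), 0 ≤ c ∧ ρ ∈ separableStates α β ∧ X = c • ρ

/-- Entanglement breaking maps: the Choi matrix is separable. The trace of the Choi matrix is free,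
as maps are not assumed to preserve the trace. -/
def IsEntanglementBreaking (L : Mat α →ₗ[ℂ] Mat β) : Prop :=
  IsSeparable (choi L)

/-- The matrix `Ω_d = [[0, I], [-I, 0]]`, with `d = 2 * n`; rows and columns `1, …, d` are indexed by
`Fin n ⊕ Fin n`. -/
def Omega (n : ℕ) : Mat (Fin n ⊕ Fin n) :=
  Matrix.fromBlocks 0 1 (-1) 0

/-- The compact symplectic group `Sp(d) = {S ∈ U(d) | Sᵀ Ω_d S = Ω_d}`, with `d = 2 * n`. -/
def Sp (n : ℕ) : Set (Mat (Fin n ⊕ Fin n)) :=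
  {S | S ∈ Matrix.unitaryGroup (Fin n ⊕ Fin n) ℂ ∧ Sᵀ * Omega n * S = Omega n}

/-- The entrywise complex conjugate of a matrix. -/
def entryConj (S : Mat α) : Mat α := S.map star

/-- `(S, S)`-covariance: `L (S Z S*) = S L(Z) S*` for all `S ∈ Sp(d)`. -/
def IsCovSS {n : ℕ} (L : Mat (Fin n ⊕ Fin n) →ₗ[ℂ] Mat (Fin n ⊕ Fin n)) : Prop :=
  ∀ S ∈ Sp n, ∀ Z, L (S * Z * Sᴴ) = S * L Z * Sᴴ

/-- `(S, S̄)`-covariance: `L (S Z S*) = S̄ L(Z) S̄*` for all `S ∈ Sp(d)`. -/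
def IsCovSSbar {n : ℕ} (L : Mat (Fin n ⊕ Fin n) →ₗ[ℂ] Mat (Fin n ⊕ Fin n)) : Prop :=
  ∀ S ∈ Sp n, ∀ Z, L (S * Z * Sᴴ) = entryConj S * L Z * (entryConj S)ᴴ

end SympPPT

end

/-! Write d = 2n. Covariance leaves three real parameters: a Hermitian-preserving covariant map is
(a, b, c) : Z ↦ a tr(Z) 1 + b Z + c Ω Zᵀ Ω*, possibly followed by conjugation with Ω. Indeed the
Sp(d)-orbit of a matrix unit E_ii spans M_d, and L(E_ii) commutes with the stabilizer of the line of
e_i, which makes it diagonal with at most three distinct entries (`exists_eq_covMap`). Since Ω S̄ =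
S Ω, conjugation with Ω exchanges the two kinds of covariance; it commutes with the maps (a, b, c)
and preserves all the properties involved. Transposition swaps b and c, up to this conjugation.

The Choi matrix is, up to scale, a·1 + b·P + c·F with F² = 1, FP = PF = -P and P² = dP. Its
eigenvalues a + c, a - c and a - c + bd decide complete positivity, and the same with b and c
swapped decides complete copositivity.

Part 1: for d ≥ 4, every PPT triple is a nonnegative combination of (1,1,1), (1,1,0), (1,0,1),
(d-1,-1,-1). Compositions of such triples land in the cone spanned by (1,0,0), (1,1,0), (1,0,1),
(d,-1,0), (d,0,-1), and these five have separable Choi matrices, by averaging product vectors over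
phases.

Part 2: positivity enters only through a, a + b, a + c ≥ 0, that is, through (a,b,c) = (a+b)(0,1,0)
+ (a+c)(0,0,1) + a(1,-1,-1). Composed with a PPT map, the first term is CP and the second completely
copositive; the third, the Breuer–Hall map, becomes decomposable by an explicit split
(`IsCovForm.isDecomposable_of_positive_ppt`). -/

noncomputable section

namespace SympPPT

open Matrix

/-! ### The compact symplectic group and unitary symplectic transvections -/

section Symplectic

variable {n : ℕ}

/-- Conjugation by `Ω`. -/
def omegaConj (n : ℕ) : Mat (Fin n ⊕ Fin n) →ₗ[ℂ] Mat (Fin n ⊕ Fin n) where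
  toFun Z := Omega n * Z * (Omega n)ᴴ
  map_add' := by intros; simp [mul_add, add_mul]
  map_smul' := by intros; simp

/-- The covariant map `Z ↦ a tr(Z) 1 + b Z + c Ω Zᵀ Ω*`. -/
def covMap (n : ℕ) (a b c : ℝ) : Mat (Fin n ⊕ Fin n) →ₗ[ℂ] Mat (Fin n ⊕ Fin n) where
  toFun Z := ((a : ℂ) * Z.trace) • (1 : Mat (Fin n ⊕ Fin n)) + (b : ℂ) • Z
    + (c : ℂ) • (Omega n * Zᵀ * (Omega n)ᴴ)
  map_add' := by
    intro X Y
    simp only [trace_add, transpose_add, mul_add, add_mul, smul_add, add_smul]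
    abel
  map_smul' := by
    intro r X
    simp only [trace_smul, transpose_smul, Matrix.mul_smul, Matrix.smul_mul, smul_add, smul_smul,
      RingHom.id_apply, smul_eq_mul]
    congr 1
    · congr 1 <;> congr 1 <;> ring
    · congr 1; ring

lemma omegaConj_apply (Z : Mat (Fin n ⊕ Fin n)) :
    omegaConj n Z = Omega n * Z * (Omega n)ᴴ := rfl

lemma covMap_apply (a b c : ℝ) (Z : Mat (Fin n ⊕ Fin n)) :
    covMap n a b c Z = ((a : ℂ) * Z.trace) • (1 : Mat (Fin n ⊕ Fin n)) + (b : ℂ) • Z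
      + (c : ℂ) • (Omega n * Zᵀ * (Omega n)ᴴ) := rfl

lemma omega_transpose : (Omega n)ᵀ = -Omega n := by
  simp [Omega, fromBlocks_transpose, fromBlocks_neg]

lemma omega_conjTranspose : (Omega n)ᴴ = -Omega n := by
  simp [Omega, fromBlocks_conjTranspose, fromBlocks_neg]

lemma omega_mul_omega : Omega n * Omega n = -1 := by
  rw [← fromBlocks_one]
  simp [Omega, fromBlocks_multiply, fromBlocks_neg, -fromBlocks_one]

lemma entryConj_omega : entryConj (Omega n) = Omega n := by
  have h : entryConj (Omega n) = (Omega n)ᴴᵀ := rfl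
  rw [h, omega_conjTranspose, transpose_neg, omega_transpose, neg_neg]

lemma entryConj_eq {α : Type*} (S : Mat α) : entryConj S = Sᴴᵀ := rfl

lemma conjTranspose_mul_self_of_mem_Sp {S : Mat (Fin n ⊕ Fin n)} (hS : S ∈ Sp n) :
    Sᴴ * S = 1 := by
  have := (mem_unitaryGroup_iff').1 hS.1
  rwa [star_eq_conjTranspose] at this

lemma mul_conjTranspose_of_mem_Sp {S : Mat (Fin n ⊕ Fin n)} (hS : S ∈ Sp n) :
    S * Sᴴ = 1 := by
  have := (mem_unitaryGroup_iff).1 hS.1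
  rwa [star_eq_conjTranspose] at this

lemma omega_mul_of_mem_Sp {S : Mat (Fin n ⊕ Fin n)} (hS : S ∈ Sp n) :
    Omega n * S = entryConj S * Omega n := by
  have h1 : entryConj S * Sᵀ = 1 := by
    rw [entryConj_eq, ← transpose_mul, mul_conjTranspose_of_mem_Sp hS, transpose_one]
  calc Omega n * S = (entryConj S * Sᵀ) * (Omega n * S) := by rw [h1, one_mul]
    _ = entryConj S * (Sᵀ * Omega n * S) := by simp only [mul_assoc]
    _ = _ := by rw [hS.2]

/-- This intertwining relation turns (S, S̄)-covariance into (S, S)-covariance after conjugation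
with Ω. -/
lemma omega_mul_entryConj_of_mem_Sp {S : Mat (Fin n ⊕ Fin n)} (hS : S ∈ Sp n) :
    Omega n * entryConj S = S * Omega n := by
  have h := omega_mul_of_mem_Sp hS
  have : S = -(Omega n * entryConj S * Omega n) := by
    rw [mul_assoc, ← h, ← mul_assoc, omega_mul_omega]; simp
  calc Omega n * entryConj S = -(Omega n * entryConj S * (Omega n * Omega n)) := by
        rw [omega_mul_omega]; simp
    _ = -(Omega n * entryConj S * Omega n) * Omega n := by simp [mul_assoc]
    _ = _ := by rw [← this]

lemma mem_Sp_of_unitary {S : Mat (Fin n ⊕ Fin n)} (h1 : Sᴴ * S = 1)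
    (h2 : Omega n * S = entryConj S * Omega n) : S ∈ Sp n := by
  refine ⟨(mem_unitaryGroup_iff').2 h1, ?_⟩
  have h3 : Sᵀ * entryConj S = 1 := by
    rw [entryConj_eq, ← transpose_mul, h1, transpose_one]
  rw [mul_assoc, h2, ← mul_assoc, h3, one_mul]

lemma covMap_covariant (a b c : ℝ) : IsCovSS (covMap n a b c) := by
  intro S hS Z
  have h1 := conjTranspose_mul_self_of_mem_Sp hS
  have h2 := mul_conjTranspose_of_mem_Sp hS
  have h3 := omega_mul_entryConj_of_mem_Sp hS
  have h4 : Sᵀ * (Omega n)ᴴ = (Omega n)ᴴ * Sᴴ := by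
    have h : (entryConj S)ᴴ = Sᵀ := by ext i j; simp [entryConj]
    rw [← h, ← conjTranspose_mul, h3, conjTranspose_mul]
  have h5 : Omega n * (S * Z * Sᴴ)ᵀ * (Omega n)ᴴ = S * (Omega n * Zᵀ * (Omega n)ᴴ) * Sᴴ := by
    rw [transpose_mul, transpose_mul, ← entryConj_eq]
    calc Omega n * (entryConj S * (Zᵀ * Sᵀ)) * (Omega n)ᴴ
        = (Omega n * entryConj S) * Zᵀ * (Sᵀ * (Omega n)ᴴ) := by simp only [mul_assoc]
      _ = _ := by rw [h3, h4]; simp only [mul_assoc]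
  rw [covMap_apply, covMap_apply, h5]
  have h6 : (S * Z * Sᴴ).trace = Z.trace := by
    rw [trace_mul_comm, ← mul_assoc, h1, one_mul]
  rw [h6]
  simp only [mul_add, add_mul, Matrix.mul_smul, Matrix.smul_mul, mul_one, h2]

/-- The antiunitary structure map `u ↦ Ω ū`. -/
def jMap (u : Fin n ⊕ Fin n → ℂ) : Fin n ⊕ Fin n → ℂ := Omega n *ᵥ star u

/-- The element `1 + α u u* + ᾱ (ju)(ju)*`. -/
def transvection (α : ℂ) (u : Fin n ⊕ Fin n → ℂ) : Mat (Fin n ⊕ Fin n) :=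
  1 + α • vecMulVec u (star u) + star α • vecMulVec (jMap u) (star (jMap u))

lemma star_omega_mulVec (u : Fin n ⊕ Fin n → ℂ) :
    star (Omega n *ᵥ u) = Omega n *ᵥ star u := by
  rw [star_mulVec, omega_conjTranspose, vecMul_neg, ← mulVec_transpose, omega_transpose,
    neg_mulVec, neg_neg]

lemma star_jMap (u : Fin n ⊕ Fin n → ℂ) : star (jMap u) = Omega n *ᵥ u := by
  rw [jMap, star_omega_mulVec, star_star]

lemma dotProduct_omega_mulVec_self (u : Fin n ⊕ Fin n → ℂ) : u ⬝ᵥ Omega n *ᵥ u = 0 := by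
  have h : u ⬝ᵥ Omega n *ᵥ u = -(u ⬝ᵥ Omega n *ᵥ u) := by
    conv_lhs => rw [dotProduct_mulVec, ← mulVec_transpose, omega_transpose, neg_mulVec,
      neg_dotProduct, dotProduct_comm]
  exact self_eq_neg.1 h

lemma star_dotProduct_jMap (u : Fin n ⊕ Fin n → ℂ) : star u ⬝ᵥ jMap u = 0 :=
  dotProduct_omega_mulVec_self _

lemma star_jMap_dotProduct (u : Fin n ⊕ Fin n → ℂ) : star (jMap u) ⬝ᵥ u = 0 := by
  rw [star_jMap, dotProduct_comm, dotProduct_omega_mulVec_self]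

lemma star_jMap_dotProduct_jMap (u : Fin n ⊕ Fin n → ℂ) :
    star (jMap u) ⬝ᵥ jMap u = star u ⬝ᵥ u := by
  rw [star_jMap, jMap, dotProduct_mulVec, ← mulVec_transpose, omega_transpose, mulVec_mulVec,
    neg_mul, omega_mul_omega, neg_neg, one_mulVec, dotProduct_comm]

lemma transvection_mulVec (α : ℂ) (u v : Fin n ⊕ Fin n → ℂ) :
    transvection α u *ᵥ v = v + (α * (star u ⬝ᵥ v)) • u
      + (star α * (star (jMap u) ⬝ᵥ v)) • jMap u := by
  simp only [transvection, add_mulVec, one_mulVec, smul_mulVec, vecMulVec_mulVec, smul_smul,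
    op_smul_eq_smul]

/-- The vectors u and ju are orthogonal and of equal norm, so unitarity decouples into one scalar
condition: 1 + α‖u‖² has modulus 1 (for u ≠ 0). Using α on u and its conjugate on ju makes the
matrix commute with the antiunitary j, which is the symplectic condition. -/
lemma transvection_mem_Sp {α : ℂ} {u : Fin n ⊕ Fin n → ℂ}
    (h : α + star α + star α * α * (star u ⬝ᵥ u) = 0) : transvection α u ∈ Sp n := by
  have hP : vecMulVec u (star u) * vecMulVec u (star u)
      = (star u ⬝ᵥ u) • vecMulVec u (star u) := by
    rw [vecMulVec_mul_vecMulVec, vecMulVec_smul]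
  have hQ : vecMulVec (jMap u) (star (jMap u)) * vecMulVec (jMap u) (star (jMap u))
      = (star u ⬝ᵥ u) • vecMulVec (jMap u) (star (jMap u)) := by
    rw [vecMulVec_mul_vecMulVec, vecMulVec_smul, star_jMap_dotProduct_jMap]
  have hPQ : vecMulVec u (star u) * vecMulVec (jMap u) (star (jMap u)) = 0 := by
    rw [vecMulVec_mul_vecMulVec, star_dotProduct_jMap]; simp
  have hQP : vecMulVec (jMap u) (star (jMap u)) * vecMulVec u (star u) = 0 := by
    rw [vecMulVec_mul_vecMulVec, star_jMap_dotProduct]; simp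
  apply mem_Sp_of_unitary
  · simp only [transvection, conjTranspose_add, conjTranspose_one, conjTranspose_smul,
      conjTranspose_vecMulVec, star_star]
    simp only [mul_add, add_mul, Matrix.mul_smul, Matrix.smul_mul, hP, hQ, hPQ, hQP, mul_one,
      one_mul, smul_zero, add_zero, smul_smul]
    have e1 : star α = -α - star α * α * (star u ⬝ᵥ u) := by linear_combination h
    have : ∀ P Q : Mat (Fin n ⊕ Fin n), 1 + star α • P + α • Q
        + (α • P + (α * (star α * (star u ⬝ᵥ u))) • P)
        + (star α • Q + (star α * (α * (star u ⬝ᵥ u))) • Q)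
        = 1 + (α + star α + star α * α * (star u ⬝ᵥ u)) • P
          + (α + star α + star α * α * (star u ⬝ᵥ u)) • Q := by
      intro P Q; module
    rw [h] at this
    simp only [zero_smul, add_zero] at this
    convert this _ _ using 3
  · have hc : entryConj (transvection α u) = 1 + star α • vecMulVec (star u) u
        + α • vecMulVec (star (jMap u)) (jMap u) := by
      ext i j
      simp [entryConj, transvection, vecMulVec_apply, Matrix.one_apply, apply_ite]
    rw [hc, transvection, star_jMap, jMap]
    simp only [mul_add, add_mul, Matrix.mul_smul, Matrix.smul_mul, mul_one, one_mul]
    rw [mul_vecMulVec, mul_vecMulVec, vecMulVec_mul, vecMulVec_mul, mulVec_mulVec,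
      omega_mul_omega, neg_mulVec, one_mulVec, ← mulVec_transpose, ← mulVec_transpose,
      omega_transpose, neg_mulVec, neg_mulVec, mulVec_mulVec, omega_mul_omega, neg_mulVec,
      one_mulVec, neg_neg, neg_vecMulVec, vecMulVec_neg]
    abel

end Symplectic

/-! ### Classification of the covariant Hermitian-preserving maps -/

section Classification

variable {n : ℕ}

/-- The signs with `Ω e_i = s_i e_{σ i}`. -/
def omegaSign : Fin n ⊕ Fin n → ℂ := Sum.elim (fun _ => -1) (fun _ => 1)

@[simp] lemma omegaSign_mul_self (i : Fin n ⊕ Fin n) : omegaSign i * omegaSign i = 1 := by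
  rcases i with i | i <;> simp [omegaSign]

@[simp] lemma star_omegaSign (i : Fin n ⊕ Fin n) : star (omegaSign i) = omegaSign i := by
  rcases i with i | i <;> simp [omegaSign]

lemma omegaSign_swap (i : Fin n ⊕ Fin n) : omegaSign i.swap = -omegaSign i := by
  rcases i with i | i <;> simp [omegaSign]

lemma swap_ne (i : Fin n ⊕ Fin n) : i.swap ≠ i := by
  rcases i with i | i <;> simp

lemma omega_apply (i j : Fin n ⊕ Fin n) :
    Omega n i j = if i = j.swap then omegaSign j else 0 := by
  rcases i with i | i <;> rcases j with j | j <;> simp [Omega, omegaSign, Matrix.one_apply]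
  split_ifs <;> simp

lemma star_single_one {α : Type*} [DecidableEq α] (i : α) :
    star (Pi.single i (1 : ℂ)) = (Pi.single i 1 : α → ℂ) := by
  rw [← Pi.single_star, star_one]

lemma omega_mulVec_single (i : Fin n ⊕ Fin n) :
    Omega n *ᵥ Pi.single i 1 = omegaSign i • Pi.single i.swap 1 := by
  ext k
  simp [omega_apply, Pi.single_apply]

/-- The vector `e_i + y e_j`. -/
def pairVec (y : ℂ) (i j : Fin n ⊕ Fin n) : Fin n ⊕ Fin n → ℂ :=
  Pi.single i 1 + y • Pi.single j 1

lemma jMap_pairVec (y : ℂ) (i j : Fin n ⊕ Fin n) :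
    jMap (pairVec y i j) = omegaSign i • Pi.single i.swap 1
      + (star y * omegaSign j) • Pi.single j.swap 1 := by
  rw [jMap, pairVec, star_add, star_smul, star_single_one, star_single_one, mulVec_add,
    mulVec_smul, omega_mulVec_single, omega_mulVec_single, smul_smul]

lemma star_pairVec_dotProduct_self {y : ℂ} (hy : star y * y = 1) {i j : Fin n ⊕ Fin n}
    (hij : i ≠ j) : star (pairVec y i j) ⬝ᵥ pairVec y i j = 2 := by
  simp only [Complex.star_def] at hy
  simp [pairVec, dotProduct_add, hij.symm, hij, mul_comm y, hy]
  norm_num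

lemma star_pairVec_dotProduct_single (y : ℂ) (i j m : Fin n ⊕ Fin n) :
    star (pairVec y i j) ⬝ᵥ Pi.single m 1
      = (if m = i then 1 else 0) + star y * (if m = j then 1 else 0) := by
  by_cases h1 : m = i <;> by_cases h2 : m = j <;> simp [pairVec, h1, h2, Pi.single_apply]

lemma star_jMap_pairVec_dotProduct_single (y : ℂ) (i j m : Fin n ⊕ Fin n) :
    star (jMap (pairVec y i j)) ⬝ᵥ Pi.single m 1
      = omegaSign i * (if m = i.swap then 1 else 0)
        + y * omegaSign j * (if m = j.swap then 1 else 0) := by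
  have := star_omegaSign i
  have := star_omegaSign j
  simp only [Complex.star_def] at *
  by_cases h1 : m = i.swap <;> by_cases h2 : m = j.swap <;>
    simp [jMap_pairVec, Pi.single_apply, *]

lemma transvection_pairVec_fix (α y : ℂ) {i j m : Fin n ⊕ Fin n} (h1 : m ≠ i) (h2 : m ≠ j)
    (h3 : m ≠ i.swap) (h4 : m ≠ j.swap) :
    transvection α (pairVec y i j) *ᵥ Pi.single m 1 = Pi.single m 1 := by
  rw [transvection_mulVec, star_pairVec_dotProduct_single, star_jMap_pairVec_dotProduct_single]
  simp [h1, h2, h3, h4]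

lemma transvection_pairVec_of_ne_swap (α y : ℂ) {i j : Fin n ⊕ Fin n} (hij : i ≠ j)
    (h : j ≠ i.swap) :
    transvection α (pairVec y i j) *ᵥ Pi.single i 1
      = (1 + α) • Pi.single i 1 + (y * α) • Pi.single j 1 := by
  have h' : i ≠ j.swap := fun e => h (by rw [e, Sum.swap_swap])
  rw [transvection_mulVec, star_pairVec_dotProduct_single, star_jMap_pairVec_dotProduct_single]
  simp only [hij, h', (swap_ne i).symm, if_true, if_false, pairVec]
  module

lemma transvection_pairVec_swap (α : ℂ) {y : ℂ} (hy : star y * y = 1) (i : Fin n ⊕ Fin n) :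
    transvection α (pairVec y i i.swap) *ᵥ Pi.single i 1
      = (1 + α + star α) • Pi.single i 1 + (y * (α - star α)) • Pi.single i.swap 1 := by
  rw [transvection_mulVec, star_pairVec_dotProduct_single, star_jMap_pairVec_dotProduct_single,
    jMap_pairVec]
  have hs := omegaSign_mul_self i
  simp only [(swap_ne i).symm, if_true, if_false, pairVec, Sum.swap_swap, omegaSign_swap]
  ext k
  simp only [Pi.add_apply, Pi.smul_apply, smul_eq_mul]
  linear_combination (star α * star y * y * (Pi.single i 1 : _ → ℂ) k
    - star α * y * (Pi.single i.swap 1 : _ → ℂ) k) * hs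
    + star α * (Pi.single i 1 : _ → ℂ) k * hy

/-- The vector e_i + y e_j has squared norm 2, so a transvection along it is admissible exactly when
|1 + 2α| = 1. The partner j = i.swap needs its own α, because there ju lies in the same plane as u.
-/
lemma exists_swap {i j : Fin n ⊕ Fin n} (hij : i ≠ j) :
    ∃ S ∈ Sp n, (∃ z : ℂ, star z * z = 1 ∧ S *ᵥ Pi.single i 1 = z • Pi.single j 1) ∧
      ∀ m, m ≠ i → m ≠ j → m ≠ i.swap → m ≠ j.swap → S *ᵥ Pi.single m 1 = Pi.single m 1 := by
  by_cases h : j = i.swap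
  · subst h
    -- Here 1 + 2α = I, and 1 + α + ᾱ = 0 removes the e_i component.
    refine ⟨transvection ((Complex.I - 1) / 2) (pairVec 1 i i.swap), ?_, ⟨Complex.I, ?_, ?_⟩, ?_⟩
    · apply transvection_mem_Sp
      rw [star_pairVec_dotProduct_self (by simp) hij]
      simp only [Complex.star_def, map_sub, map_div₀, Complex.conj_I, map_one, map_ofNat]
      linear_combination (-1 / 2 : ℂ) * Complex.I_sq
    · simp
    · rw [transvection_pairVec_swap _ (by simp)]
      simp only [Complex.star_def, map_sub, map_div₀, Complex.conj_I, map_one, map_ofNat]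
      module
    · exact fun m h1 h2 h3 h4 => transvection_pairVec_fix _ _ h1 h2 h3 h4
  · refine ⟨transvection (-1) (pairVec 1 i j), ?_, ⟨-1, by simp, ?_⟩, ?_⟩
    · apply transvection_mem_Sp
      rw [star_pairVec_dotProduct_self (by simp) hij]
      simp
      norm_num
    · rw [transvection_pairVec_of_ne_swap _ _ hij h]
      module
    · exact fun m h1 h2 h3 h4 => transvection_pairVec_fix _ _ h1 h2 h3 h4

/-- The free phase y separates E_ij from E_ji in the conjugate of E_ii; the nonzero product p q̄
ensures that both occur. -/
lemma exists_mix {i j : Fin n ⊕ Fin n} (hij : i ≠ j) :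
    ∃ p q : ℂ, p * star q ≠ 0 ∧ q * star p = -(p * star q) ∧
      ∀ y : ℂ, star y * y = 1 → ∃ S ∈ Sp n,
        S *ᵥ Pi.single i 1 = p • Pi.single i 1 + (y * q) • Pi.single j 1 := by
  by_cases h : j = i.swap
  · subst h
    -- A Pythagorean choice: 1 + 2α = (3 + 4I)/5, whose real and imaginary parts give p and q.
    refine ⟨3 / 5, 4 * Complex.I / 5, by simp, by simp; ring, fun y hy =>
      ⟨transvection ((-1 + 2 * Complex.I) / 5) (pairVec y i i.swap), ?_, ?_⟩⟩
    · apply transvection_mem_Sp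
      rw [star_pairVec_dotProduct_self hy hij]
      simp only [Complex.star_def, map_add, map_mul, map_neg, map_div₀, Complex.conj_I, map_one,
        map_ofNat]
      linear_combination (-8 / 25 : ℂ) * Complex.I_sq
    · rw [transvection_pairVec_swap _ hy]
      simp only [Complex.star_def, map_add, map_mul, map_neg, map_div₀, Complex.conj_I, map_one,
        map_ofNat]
      module
  · refine ⟨(1 + Complex.I) / 2, (Complex.I - 1) / 2, ?_, ?_, fun y hy =>
      ⟨transvection ((Complex.I - 1) / 2) (pairVec y i j), ?_, ?_⟩⟩
    · have : (1 + Complex.I) / 2 * star ((Complex.I - 1) / 2) = -Complex.I / 2 := by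
        simp only [Complex.star_def, map_sub, map_div₀, Complex.conj_I, map_one, map_ofNat]
        linear_combination (-1 / 4 : ℂ) * Complex.I_sq
      rw [this]
      simp
    · simp only [Complex.star_def, map_add, map_sub, map_div₀, Complex.conj_I, map_one, map_ofNat]
      linear_combination (-1 / 2 : ℂ) * Complex.I_sq
    · apply transvection_mem_Sp
      rw [star_pairVec_dotProduct_self hy hij]
      simp only [Complex.star_def, map_sub, map_div₀, Complex.conj_I, map_one, map_ofNat]
      linear_combination (-1 / 2 : ℂ) * Complex.I_sq
    · rw [transvection_pairVec_of_ne_swap _ _ hij h]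
      module

lemma diagonal_mem_Sp {z : Fin n ⊕ Fin n → ℂ} (h1 : ∀ i, star (z i) * z i = 1)
    (h2 : ∀ i, z i.swap = star (z i)) : diagonal z ∈ Sp n := by
  apply mem_Sp_of_unitary
  · rw [diagonal_conjTranspose, diagonal_mul_diagonal, ← diagonal_one]
    congr 1
    ext i
    exact h1 i
  · have : entryConj (diagonal z) = diagonal (star z) := by
      rw [entryConj_eq, diagonal_conjTranspose, diagonal_transpose]
    rw [this]
    ext i j
    rw [mul_diagonal, diagonal_mul, omega_apply]
    split_ifs with h
    · simp [h, h2, mul_comm]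
    · simp

lemma conj_single_self (S : Mat (Fin n ⊕ Fin n)) (i : Fin n ⊕ Fin n) :
    S * single i i 1 * Sᴴ = vecMulVec (S *ᵥ Pi.single i 1) (star (S *ᵥ Pi.single i 1)) := by
  ext k l
  simp [vecMulVec_apply, Matrix.mul_apply, single_apply, Finset.sum_ite_eq, ite_and]

/-- `L (E_ii)` commutes with the stabilizer of the line through `e_i`. -/
lemma commute_of_fix {L : Mat (Fin n ⊕ Fin n) →ₗ[ℂ] Mat (Fin n ⊕ Fin n)} (hL : IsCovSS L)
    {S : Mat (Fin n ⊕ Fin n)} (hS : S ∈ Sp n) {i : Fin n ⊕ Fin n} {z : ℂ} (hz : star z * z = 1)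
    (h : S *ᵥ Pi.single i 1 = z • Pi.single i 1) :
    S * L (single i i 1) = L (single i i 1) * S := by
  have h1 : S * single i i 1 * Sᴴ = single i i 1 := by
    rw [conj_single_self, h]
    rw [star_smul, star_single_one, smul_vecMulVec, vecMulVec_smul, smul_smul, mul_comm, hz,
      one_smul, ← single_eq_single_vecMulVec_single]
  have h2 := hL S hS (single i i 1)
  rw [h1] at h2
  conv_rhs => rw [h2, mul_assoc, conjTranspose_mul_self_of_mem_Sp hS, mul_one]

lemma apply_single_offDiag {L : Mat (Fin n ⊕ Fin n) →ₗ[ℂ] Mat (Fin n ⊕ Fin n)}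
    (hL : IsCovSS L) (i : Fin n ⊕ Fin n) {k l : Fin n ⊕ Fin n} (hkl : k ≠ l) :
    L (single i i 1) k l = 0 := by
  -- A torus element whose entry at k differs from all its other entries; commuting with it kills
  -- the rest of row k.
  set z : Fin n ⊕ Fin n → ℂ := fun m =>
    if m = k then Complex.I else if m = k.swap then -Complex.I else 1 with hz
  have hk := swap_ne k
  have h1 : ∀ i, star (z i) * z i = 1 := by
    intro i
    simp only [hz]
    split_ifs <;> simp
  have h2 : ∀ i, z i.swap = star (z i) := by
    intro i
    by_cases e1 : i = k
    · simp [hz, e1, hk]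
    · by_cases e2 : i = k.swap
      · simp [hz, e2, hk]
      · have e3 : i.swap ≠ k := fun e => e2 (by rw [← e, Sum.swap_swap])
        have e4 : i.swap ≠ k.swap := fun e => e1 (by rw [← i.swap_swap, e, Sum.swap_swap])
        simp [hz, e1, e2, e3, e4]
  have h3 := commute_of_fix hL (diagonal_mem_Sp h1 h2) (i := i) (h1 i)
    (by ext m; by_cases e : m = i <;> simp [mulVec_diagonal, e])
  have h4 := congrFun (congrFun h3 k) l
  rw [diagonal_mul, mul_diagonal] at h4
  have h5 : z k - z l ≠ 0 := by
    have : z k = Complex.I := by simp [hz]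
    rw [this]
    simp only [hz, hkl.symm, if_false]
    split_ifs
    · intro h
      have := congrArg Complex.im h
      norm_num at this
    · intro h
      have := congrArg Complex.im h
      norm_num at this
  have h6 : (z k - z l) * L (single i i 1) k l = 0 := by linear_combination h4
  exact (mul_eq_zero.1 h6).resolve_left h5

/-- The stabilizer of e_i still carries e_k to a multiple of e_l, and L(E_ii) commutes with it. -/
lemma apply_single_diag_eq {L : Mat (Fin n ⊕ Fin n) →ₗ[ℂ] Mat (Fin n ⊕ Fin n)}
    (hL : IsCovSS L) {i k l : Fin n ⊕ Fin n} (hk : k ≠ i) (hk' : k ≠ i.swap) (hl : l ≠ i)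
    (hl' : l ≠ i.swap) : L (single i i 1) k k = L (single i i 1) l l := by
  by_cases hkl : k = l
  · rw [hkl]
  obtain ⟨S, hS, ⟨z, hz, hSk⟩, hfix⟩ := exists_swap hkl
  have h1 := commute_of_fix hL hS (i := i) (z := 1) (by simp) (by
    rw [one_smul]
    refine hfix i hk.symm hl.symm ?_ ?_
    · exact fun e => hk' (by rw [e, Sum.swap_swap])
    · exact fun e => hl' (by rw [e, Sum.swap_swap]))
  have hA : L (single i i 1) = diagonal (fun m => L (single i i 1) m m) := by
    ext a b
    by_cases e : a = b
    · simp [e]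
    · rw [apply_single_offDiag hL i e, diagonal_apply_ne _ e]
  have h2 : ∀ m, S l m = if m = k then z else S l m := by
    intro m
    split_ifs with e
    · have := congrFun hSk l
      simpa [e] using this
    · rfl
  have h3 := congrFun (congrFun h1 l) k
  rw [hA, mul_diagonal, diagonal_mul, h2 k, if_pos rfl] at h3
  have hz0 : z ≠ 0 := by rintro rfl; simp at hz
  exact mul_left_cancel₀ hz0 (by rw [h3, mul_comm])

lemma omega_single_omega (i : Fin n ⊕ Fin n) :
    Omega n * (single i i 1)ᵀ * (Omega n)ᴴ = single i.swap i.swap (1 : ℂ) := by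
  rw [transpose_single, conj_single_self, omega_mulVec_single]
  rw [star_smul, star_single_one, smul_vecMulVec, vecMulVec_smul, smul_smul, star_omegaSign,
    omegaSign_mul_self, one_smul, ← single_eq_single_vecMulVec_single]

lemma conj_single_mix {S : Mat (Fin n ⊕ Fin n)} {i j : Fin n ⊕ Fin n} {p q : ℂ}
    (h : S *ᵥ Pi.single i 1 = p • Pi.single i 1 + q • Pi.single j 1) :
    S * single i i 1 * Sᴴ = (p * star p) • single i i 1 + (q * star q) • single j j 1
      + (p * star q) • single i j 1 + (q * star p) • single j i 1 := by
  rw [conj_single_self, h]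
  simp only [star_add, star_smul, star_single_one, add_vecMulVec, vecMulVec_add, smul_vecMulVec,
    vecMulVec_smul, single_eq_single_vecMulVec_single]
  module

/-- A covariant map is determined by its value at one diagonal matrix unit. -/
lemma eq_of_apply_single_eq {L M : Mat (Fin n ⊕ Fin n) →ₗ[ℂ] Mat (Fin n ⊕ Fin n)}
    (hL : IsCovSS L) (hM : IsCovSS M) {i₀ : Fin n ⊕ Fin n}
    (h : L (single i₀ i₀ 1) = M (single i₀ i₀ 1)) : L = M := by
  -- K is a subspace invariant under conjugation by Sp(d), so it suffices to reach every matrix unit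
  -- from one of them.
  set K := LinearMap.eqLocus L M with hK
  have hinv : ∀ S ∈ Sp n, ∀ Z ∈ K, S * Z * Sᴴ ∈ K := by
    intro S hS Z hZ
    rw [hK, LinearMap.mem_eqLocus] at hZ ⊢
    rw [hL S hS, hM S hS, hZ]
  have h0 : single i₀ i₀ (1 : ℂ) ∈ K := h
  have hdiag : ∀ j, single j j (1 : ℂ) ∈ K := by
    intro j
    by_cases e : i₀ = j
    · rwa [← e]
    obtain ⟨S, hS, ⟨z, hz, hSz⟩, -⟩ := exists_swap e
    have h1 := hinv S hS _ h0
    rw [conj_single_mix (p := 0) (q := z) (j := j) (by rw [hSz]; simp)] at h1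
    rw [mul_comm z, hz] at h1
    simpa using h1
  have hoff : ∀ i j, single i j (1 : ℂ) ∈ K := by
    intro i j
    by_cases e : i = j
    · rw [e]; exact hdiag j
    obtain ⟨p, q, hpq, hqp, hS⟩ := exists_mix e
    have key : ∀ y : ℂ, star y * y = 1 →
        star y • single i j (1 : ℂ) - y • single j i (1 : ℂ) ∈ K := by
      intro y hy
      obtain ⟨S, hS, hSi⟩ := hS y hy
      have h1 := hinv S hS _ (hdiag i)
      rw [conj_single_mix hSi] at h1
      have h2 := K.sub_mem h1 (K.add_mem (K.smul_mem (p * star p) (hdiag i))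
        (K.smul_mem (y * q * star (y * q)) (hdiag j)))
      refine (K.smul_mem_iff hpq).1 ?_
      convert h2 using 1
      have e2 : y * q * star p = -(y * (p * star q)) := by rw [← mul_neg, ← hqp]; ring
      rw [e2, star_mul']
      module
    -- The phases 1 and I give E_ij - E_ji and -I(E_ij + E_ji), which together span E_ij.
    have k1 := key 1 (by simp)
    have k2 := key Complex.I (by simp)
    have k3 := K.smul_mem (1 / 2 : ℂ) (K.add_mem k1 (K.smul_mem Complex.I k2))
    convert k3 using 1
    simp only [star_one, Complex.star_def, Complex.conj_I, smul_sub, smul_add, smul_smul, mul_neg,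
      Complex.I_mul_I]
    module
  ext1 Z
  have : Z ∈ K := by
    rw [matrix_eq_sum_single Z]
    refine K.sum_mem fun i _ => K.sum_mem fun j _ => ?_
    rw [← mul_one (Z i j), ← smul_eq_mul, ← smul_single]
    exact K.smul_mem _ (hoff i j)
  exact this

/-- The parameters are read off the diagonal of L(E_ii): a + b at i, a + c at i.swap, and a at any
other index k. Such a k exists because n ≥ 2. -/
theorem exists_eq_covMap (hn : 2 ≤ n) {L : Mat (Fin n ⊕ Fin n) →ₗ[ℂ] Mat (Fin n ⊕ Fin n)}
    (hL : IsCovSS L) (hH : IsHermitianPreserving L) : ∃ a b c : ℝ, L = covMap n a b c := by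
  set i : Fin n ⊕ Fin n := Sum.inl ⟨0, by omega⟩ with hi
  set k : Fin n ⊕ Fin n := Sum.inl ⟨1, by omega⟩ with hk
  have hki : k ≠ i := by simp [hi, hk]
  have hki' : k ≠ i.swap := by simp [hi, hk]
  have hreal : ∀ m, (((L (single i i 1) m m).re : ℝ) : ℂ) = L (single i i 1) m m := by
    intro m
    have h1 := hH (single i i 1)
    rw [conjTranspose_single, star_one] at h1
    have h2 := congrFun (congrFun h1 m) m
    rw [conjTranspose_apply] at h2
    exact Complex.conj_eq_iff_re.1 h2.symm
  refine ⟨(L (single i i 1) k k).re, (L (single i i 1) i i).re - (L (single i i 1) k k).re,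
    (L (single i i 1) i.swap i.swap).re - (L (single i i 1) k k).re,
    eq_of_apply_single_eq hL (covMap_covariant _ _ _) (i₀ := i) ?_⟩
  rw [covMap_apply, omega_single_omega]
  simp only [Complex.ofReal_sub, hreal]
  ext a b
  by_cases hab : a = b
  · subst hab
    by_cases h1 : a = i
    · simp [h1, swap_ne]
    · by_cases h2 : a = i.swap
      · simp [h2, (swap_ne i).symm]
      · rw [apply_single_diag_eq hL h1 h2 hki hki']
        simp [Ne.symm h1, Ne.symm h2]
  · rw [apply_single_offDiag hL i hab]
    have : ∀ (m : Fin n ⊕ Fin n) (z : ℂ), single m m z a b = 0 := fun m z =>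
      single_apply_of_ne _ _ _ _ _ (fun e => hab (e.1.symm.trans e.2))
    simp [this, hab]

lemma omegaConj_omegaConj (Z : Mat (Fin n ⊕ Fin n)) : omegaConj n (omegaConj n Z) = Z := by
  rw [omegaConj_apply, omegaConj_apply, omega_conjTranspose]
  calc Omega n * (Omega n * Z * -Omega n) * -Omega n
      = (Omega n * Omega n) * Z * (Omega n * Omega n) := by simp [mul_assoc]
    _ = Z := by simp [omega_mul_omega]

theorem exists_eq_omegaConj_covMap (hn : 2 ≤ n)
    {L : Mat (Fin n ⊕ Fin n) →ₗ[ℂ] Mat (Fin n ⊕ Fin n)}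
    (hL : IsCovSSbar L) (hH : IsHermitianPreserving L) :
    ∃ a b c : ℝ, L = omegaConj n ∘ₗ covMap n a b c := by
  obtain ⟨a, b, c, h⟩ := exists_eq_covMap hn (L := omegaConj n ∘ₗ L) (by
    intro S hS Z
    have h1 := omega_mul_entryConj_of_mem_Sp hS
    rw [LinearMap.comp_apply, LinearMap.comp_apply, hL S hS, omegaConj_apply, omegaConj_apply]
    calc Omega n * (entryConj S * L Z * (entryConj S)ᴴ) * (Omega n)ᴴ
        = (Omega n * entryConj S) * L Z * (Omega n * entryConj S)ᴴ := by
          simp only [conjTranspose_mul, mul_assoc]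
      _ = _ := by rw [h1]; simp only [conjTranspose_mul, mul_assoc]) (by
    intro Z
    rw [LinearMap.comp_apply, LinearMap.comp_apply, hH, omegaConj_apply, omegaConj_apply]
    simp only [conjTranspose_mul, conjTranspose_conjTranspose, mul_assoc])
  refine ⟨a, b, c, ?_⟩
  rw [← h]
  ext1 Z
  exact (omegaConj_omegaConj (L Z)).symm

end Classification

/-! ### Choi's criterion for complete positivity -/

section Choi

variable {α β : Type*} [Fintype α] [DecidableEq α]

/-- The unnormalized Choi matrix. -/
def rawChoi (L : Mat α →ₗ[ℂ] Mat β) : Mat (α × β) :=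
  of fun p q => L (single p.1 q.1 1) p.2 q.2

lemma choi_eq (L : Mat α →ₗ[ℂ] Mat β) :
    choi L = (1 / (Fintype.card α : ℂ)) • rawChoi L := by
  rw [choi]
  congr 1
  ext p q
  simp [rawChoi, Matrix.sum_apply, single_apply, ite_and]

lemma partialTranspose_choi_eq (L : Mat α →ₗ[ℂ] Mat β) :
    partialTranspose (choi L) = (1 / (Fintype.card α : ℂ)) • rawChoi (transp β ∘ₗ L) := by
  ext p q
  simp [choi_eq, partialTranspose, ampliation, transp, rawChoi]

lemma ampliation_apply_eq_sum {κ : Type*} (L : Mat α →ₗ[ℂ] Mat β) (X : Mat (κ × α))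
    (p q : κ × β) :
    ampliation κ L X p q = ∑ a, ∑ a', X (p.1, a) (q.1, a') * rawChoi L (a, p.2) (a', q.2) := by
  have h : (of fun a b => X (p.1, a) (q.1, b))
      = ∑ a, ∑ a', X (p.1, a) (q.1, a') • single a a' (1 : ℂ) := by
    rw [matrix_eq_sum_single (of fun a b => X (p.1, a) (q.1, b))]
    simp [smul_single]
  simp only [ampliation, of_apply, h, map_sum, map_smul, Matrix.sum_apply, Matrix.smul_apply,
    smul_eq_mul, rawChoi]

theorem isCP_of_rawChoi_posSemidef [Fintype β] [DecidableEq β] {L : Mat α →ₗ[ℂ] Mat β}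
    (h : (rawChoi L).PosSemidef) :
    IsCP L := by
  intro k _ X hX
  set f : (Fin k × β) × α → (Fin k × α) × (α × β) := fun r => ((r.1.1, r.2), (r.2, r.1.2))
  -- V sums over the auxiliary index in α, which contracts X ⊗ C to the ampliation and exhibits it
  -- as a congruence of a positive matrix.
  set V : Matrix ((Fin k × β) × α) (Fin k × β) ℂ :=
    (1 : Mat (Fin k × β)).submatrix Prod.fst id
  have hY := ((hX.kronecker h).submatrix f).conjTranspose_mul_mul_same V
  have hE : ampliation (Fin k) L X = Vᴴ * (X ⊗ₖ rawChoi L).submatrix f f * V := by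
    ext p q
    rw [ampliation_apply_eq_sum]
    simp [V, f, Matrix.mul_apply, Fintype.sum_prod_type, Matrix.one_apply, Prod.ext_iff, ite_and,
      apply_ite]
    exact Finset.sum_comm
  rwa [hE]

theorem rawChoi_posSemidef_of_isCP [Nonempty α] {L : Mat α →ₗ[ℂ] Mat β} (h : IsCP L) :
    (rawChoi L).PosSemidef := by
  set e := (Fintype.equivFin α).symm
  -- Ampliation of the maximally entangled projection is the Choi matrix itself.
  set v : Fin (Fintype.card α) × α → ℂ := fun p => if e p.1 = p.2 then 1 else 0 with hv
  have h1 := h (Fintype.card α) Fintype.card_pos _ (posSemidef_vecMulVec_self_star v)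
  rw [← posSemidef_submatrix_equiv (e.prodCongr (Equiv.refl β))]
  convert h1 using 1
  ext p q
  rw [ampliation_apply_eq_sum]
  simp [hv, vecMulVec_apply, Prod.map]

theorem isCP_iff_rawChoi_posSemidef [Fintype β] [DecidableEq β] [Nonempty α]
    {L : Mat α →ₗ[ℂ] Mat β} :
    IsCP L ↔ (rawChoi L).PosSemidef :=
  ⟨rawChoi_posSemidef_of_isCP, isCP_of_rawChoi_posSemidef⟩

lemma IsPPTMap.isCoCP [Fintype β] [DecidableEq β] [Nonempty α]
    {L : Mat α →ₗ[ℂ] Mat β} (h : IsPPTMap L) : IsCoCP L := by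
  apply isCP_of_rawChoi_posSemidef
  have h1 := h.2
  rw [partialTranspose_choi_eq] at h1
  have hd : (Fintype.card α : ℂ) ≠ 0 := by simp
  have h2 := h1.smul (a := (Fintype.card α : ℂ)) (by positivity)
  rwa [smul_smul, mul_one_div_cancel hd, one_smul] at h2

lemma one_kronecker_conj_apply [Fintype β] (U : Mat β) (C : Mat (α × β)) (p q : α × β) :
    (((1 : Mat α) ⊗ₖ U : Mat (α × β)) * C * ((1 : Mat α) ⊗ₖ U : Mat (α × β))ᴴ) p q
      = (U * of (fun k l => C (p.1, k) (q.1, l)) * Uᴴ) p.2 q.2 := by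
  simp only [conjTranspose_kronecker, Matrix.mul_apply, kroneckerMap_apply,
    Fintype.sum_prod_type, conjTranspose_one, Matrix.one_apply, of_apply]
  rw [Finset.sum_eq_single q.1]
  · refine Finset.sum_congr rfl fun x _ => ?_
    rw [if_pos rfl, one_mul, Finset.sum_eq_single p.1]
    · simp
    · intro b _ hb
      simp [Ne.symm hb]
    · simp
  · intro b _ hb
    simp [hb]
  · simp

end Choi

/-! ### Spectrum of the Choi matrices of covariant maps -/

section CovMapChoi

variable {n : ℕ}

lemma rawChoi_omegaConj_comp (L : Mat (Fin n ⊕ Fin n) →ₗ[ℂ] Mat (Fin n ⊕ Fin n)) :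
    rawChoi (omegaConj n ∘ₗ L)
      = ((1 : Mat (Fin n ⊕ Fin n)) ⊗ₖ Omega n) * rawChoi L * (1 ⊗ₖ Omega n)ᴴ := by
  ext p q
  rw [one_kronecker_conj_apply]
  rfl

lemma isCP_omegaConj_comp {L : Mat (Fin n ⊕ Fin n) →ₗ[ℂ] Mat (Fin n ⊕ Fin n)}
    [Nonempty (Fin n ⊕ Fin n)] (h : IsCP L) : IsCP (omegaConj n ∘ₗ L) := by
  rw [isCP_iff_rawChoi_posSemidef] at h ⊢
  rw [rawChoi_omegaConj_comp]
  exact h.mul_mul_conjTranspose_same _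

/-- The unnormalized maximally entangled vector. -/
def maxEnt (α : Type*) [DecidableEq α] : α × α → ℂ := fun p => if p.1 = p.2 then 1 else 0

/-- The flip, twisted by `Ω`: the Choi matrix of `Z ↦ Ω Zᵀ Ω*`. -/
def omegaFlip (n : ℕ) : Mat ((Fin n ⊕ Fin n) × (Fin n ⊕ Fin n)) :=
  of fun p q => Omega n p.2 q.1 * Omega n q.2 p.1

lemma star_maxEnt (α : Type*) [DecidableEq α] : star (maxEnt α) = maxEnt α := by
  ext p
  by_cases h : p.1 = p.2 <;> simp [maxEnt, h]

lemma rawChoi_covMap (a b c : ℝ) :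
    rawChoi (covMap n a b c) = (a : ℂ) • (1 : Mat ((Fin n ⊕ Fin n) × (Fin n ⊕ Fin n)))
      + (b : ℂ) • vecMulVec (maxEnt _) (star (maxEnt _)) + (c : ℂ) • omegaFlip n := by
  have h : ∀ i j k l : Fin n ⊕ Fin n,
      (Omega n * single j i (1 : ℂ) * (Omega n)ᴴ) k l = Omega n k j * Omega n l i := by
    intro i j k l
    have : (Omega n)ᴴ = (Omega n)ᵀ := by rw [omega_conjTranspose, omega_transpose]
    rw [this]
    simp [Matrix.mul_apply, single_apply, ite_and]
  ext ⟨i, k⟩ ⟨j, l⟩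
  rw [star_maxEnt]
  simp only [rawChoi, of_apply, covMap_apply, transpose_single, Matrix.add_apply,
    Matrix.smul_apply, h, smul_eq_mul, omegaFlip, vecMulVec_apply, maxEnt]
  congr 2
  · by_cases h1 : i = j <;> by_cases h2 : k = l <;> simp [h1, h2, Matrix.one_apply]
  · by_cases h1 : i = k <;> by_cases h2 : j = l <;> simp [h1, h2]

lemma omegaFlip_conjTranspose : (omegaFlip n)ᴴ = omegaFlip n := by
  have h : ∀ i j, star (Omega n i j) = Omega n i j := fun i j =>
    congrFun (congrFun entryConj_omega i) j
  ext p q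
  rw [conjTranspose_apply]
  simp only [omegaFlip, of_apply, star_mul', h, mul_comm]

lemma omegaFlip_mul_self : omegaFlip n * omegaFlip n = 1 := by
  have h1 : ∀ i j, ∑ k, Omega n i k * Omega n j k = (1 : Mat (Fin n ⊕ Fin n)) i j := by
    intro i j
    have : Omega n * (Omega n)ᵀ = 1 := by rw [omega_transpose, mul_neg, omega_mul_omega, neg_neg]
    rw [← this]
    simp [Matrix.mul_apply]
  have h2 : ∀ i j, ∑ k, Omega n k i * Omega n k j = (1 : Mat (Fin n ⊕ Fin n)) i j := by
    intro i j
    have : (Omega n)ᵀ * Omega n = 1 := by rw [omega_transpose, neg_mul, omega_mul_omega, neg_neg]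
    rw [← this]
    simp [Matrix.mul_apply]
  ext ⟨i, k⟩ ⟨j, l⟩
  have : ∀ x y, Omega n k x * Omega n y i * (Omega n y j * Omega n l x)
      = (Omega n k x * Omega n l x) * (Omega n y i * Omega n y j) := by intros; ring
  simp only [omegaFlip, Matrix.mul_apply, Fintype.sum_prod_type, of_apply, this,
    ← Finset.mul_sum, ← Finset.sum_mul, h1, h2]
  by_cases e1 : i = j <;> by_cases e2 : k = l <;> simp [e1, e2, Matrix.one_apply]

/-- The sign is that of Ω² = -1; it puts the maximally entangled vector in the (-1)-eigenspace of
the twisted flip. -/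
lemma omegaFlip_mulVec_maxEnt : omegaFlip n *ᵥ maxEnt _ = -maxEnt _ := by
  ext ⟨i, k⟩
  have h := congrFun (congrFun (omega_mul_omega (n := n)) k) i
  rw [Matrix.mul_apply] at h
  simp only [mulVec, dotProduct, omegaFlip, of_apply, maxEnt, Fintype.sum_prod_type, mul_ite,
    mul_one, mul_zero, Finset.sum_ite_eq, Finset.mem_univ, if_true, h]
  by_cases e : i = k <;> simp [maxEnt, e, eq_comm]

lemma maxEnt_dotProduct_self (α : Type*) [Fintype α] [DecidableEq α] :
    maxEnt α ⬝ᵥ maxEnt α = Fintype.card α := by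
  simp [dotProduct, maxEnt, Fintype.sum_prod_type]

/-- The unnormalized projection onto the maximally entangled vector. -/
abbrev maxEntProj (n : ℕ) : Mat ((Fin n ⊕ Fin n) × (Fin n ⊕ Fin n)) :=
  vecMulVec (maxEnt _) (star (maxEnt _))

lemma omegaFlip_mul_maxEntProj : omegaFlip n * maxEntProj n = -maxEntProj n := by
  rw [maxEntProj, mul_vecMulVec, omegaFlip_mulVec_maxEnt, neg_vecMulVec]

lemma maxEntProj_conjTranspose : (maxEntProj n)ᴴ = maxEntProj n := by
  rw [conjTranspose_vecMulVec, star_star]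

lemma maxEntProj_mul_omegaFlip : maxEntProj n * omegaFlip n = -maxEntProj n := by
  have h := congrArg conjTranspose (omegaFlip_mul_maxEntProj (n := n))
  rwa [conjTranspose_mul, conjTranspose_neg, omegaFlip_conjTranspose,
    maxEntProj_conjTranspose] at h

lemma maxEntProj_mul_self : maxEntProj n * maxEntProj n = (2 * n : ℂ) • maxEntProj n := by
  rw [vecMulVec_mul_vecMulVec, vecMulVec_smul, star_maxEnt, maxEnt_dotProduct_self]
  simp [two_mul, maxEntProj, star_maxEnt]

lemma posSemidef_of_mul_self_eq {ι : Type*} [Fintype ι] {R : Mat ι} (h1 : Rᴴ = R)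
    (h2 : R * R = (2 : ℂ) • R) : R.PosSemidef := by
  have h3 := (posSemidef_conjTranspose_mul_self R).smul (a := (1 / 2 : ℂ)) (by positivity)
  rw [h1, h2, smul_smul] at h3
  simpa using h3

/-- Spectral decomposition: up to scale, the projections are 1 + F, then 1 - F with the maximally
entangled part P/n removed, then P. The three hypotheses say that the eigenvalues on them are
nonnegative. -/
theorem isCP_covMap_of_le (hn : 1 ≤ n) {a b c : ℝ} (h1 : 0 ≤ a + c) (h2 : 0 ≤ a - c)
    (h3 : 0 ≤ a - c + b * (2 * n)) : IsCP (covMap n a b c) := by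
  have hn0 : (n : ℂ) ≠ 0 := by exact_mod_cast (by omega : n ≠ 0)
  apply isCP_of_rawChoi_posSemidef
  rw [rawChoi_covMap]
  have p1 : (1 + omegaFlip n).PosSemidef := by
    apply posSemidef_of_mul_self_eq
    · rw [conjTranspose_add, omegaFlip_conjTranspose, conjTranspose_one]
    · rw [mul_add, add_mul, add_mul, omegaFlip_mul_self]
      simp only [one_mul, mul_one]
      module
  have p2 : (1 - omegaFlip n - (1 / n : ℂ) • maxEntProj n).PosSemidef := by
    apply posSemidef_of_mul_self_eq
    · rw [conjTranspose_sub, conjTranspose_sub, omegaFlip_conjTranspose, conjTranspose_one,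
        conjTranspose_smul, maxEntProj_conjTranspose]
      simp
    · simp only [mul_sub, sub_mul, Matrix.mul_smul, Matrix.smul_mul, omegaFlip_mul_self,
        omegaFlip_mul_maxEntProj, maxEntProj_mul_omegaFlip, maxEntProj_mul_self, one_mul, mul_one,
        smul_smul]
      rw [show 1 / (n : ℂ) * (1 / n * (2 * n)) = 2 * (1 / n) by field_simp]
      module
  have p3 : (maxEntProj n).PosSemidef := posSemidef_vecMulVec_self_star _
  have q1 := p1.smul (a := (((a + c) / 2 : ℝ) : ℂ)) (by exact_mod_cast div_nonneg h1 (by simp))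
  have q2 := p2.smul (a := (((a - c) / 2 : ℝ) : ℂ)) (by exact_mod_cast div_nonneg h2 (by simp))
  have q3 := p3.smul (a := (((a - c + b * (2 * n)) / (2 * n) : ℝ) : ℂ))
    (by exact_mod_cast div_nonneg h3 (by positivity))
  convert (q1.add q2).add q3 using 1
  have e : (((a - c + b * (2 * n)) / (2 * n) : ℝ) : ℂ) = (a - c) / 2 * (1 / n) + b := by
    push_cast; field_simp
  rw [e]
  push_cast
  module

theorem le_of_isCP_covMap (hn : 2 ≤ n) {a b c : ℝ} (h : IsCP (covMap n a b c)) :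
    0 ≤ a + c ∧ 0 ≤ a - c ∧ 0 ≤ a - c + b * (2 * n) := by
  set i : Fin n ⊕ Fin n := Sum.inl ⟨0, by omega⟩ with hi
  set k : Fin n ⊕ Fin n := Sum.inl ⟨1, by omega⟩ with hk
  have : Nonempty (Fin n ⊕ Fin n) := ⟨i⟩
  have hC := rawChoi_posSemidef_of_isCP h
  rw [rawChoi_covMap] at hC
  refine ⟨?_, ?_, ?_⟩
  · have h1 := hC.diag_nonneg (i := (i, i.swap))
    simp only [Matrix.add_apply, Matrix.smul_apply, Matrix.one_apply_eq, vecMulVec_apply, maxEnt,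
      (swap_ne i).symm, if_false, omegaFlip, of_apply, omega_apply, if_true, omegaSign_mul_self,
      smul_eq_mul, mul_one, zero_mul, mul_zero, add_zero] at h1
    exact_mod_cast h1
  -- Compressing to the (-1)-eigenspace and taking the diagonal entry at (i, k), with k different
  -- from i and i.swap, isolates a - c: P and F vanish at that entry.
  · have h1 := hC.mul_mul_conjTranspose_same (1 - omegaFlip n)
    have h2 : (1 - omegaFlip n) * ((a : ℂ) • 1 + (b : ℂ) • maxEntProj n + (c : ℂ) • omegaFlip n)
        * (1 - omegaFlip n)ᴴ
        = (2 * (a - c) : ℂ) • (1 - omegaFlip n) + (4 * b : ℂ) • maxEntProj n := by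
      rw [conjTranspose_sub, omegaFlip_conjTranspose, conjTranspose_one]
      simp only [mul_sub, sub_mul, mul_add, add_mul, Matrix.mul_smul, Matrix.smul_mul,
        omegaFlip_mul_self, omegaFlip_mul_maxEntProj, maxEntProj_mul_omegaFlip, neg_mul,
        one_mul, mul_one]
      module
    rw [h2] at h1
    have h3 := h1.diag_nonneg (i := (i, k))
    have hik : i ≠ k := by simp [hi, hk]
    have hik' : k ≠ i.swap := by simp [hi, hk]
    simp only [Matrix.add_apply, Matrix.sub_apply, Matrix.smul_apply, Matrix.one_apply_eq,
      vecMulVec_apply, maxEnt, hik, hik', if_false, omegaFlip, of_apply, omega_apply,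
      smul_eq_mul, mul_one, zero_mul, mul_zero, add_zero, sub_zero] at h3
    have : 0 ≤ 2 * (a - c) := by exact_mod_cast h3
    linarith
  · have h1 := hC.dotProduct_mulVec_nonneg (maxEnt _)
    have hd := maxEnt_dotProduct_self (Fin n ⊕ Fin n)
    simp only [add_mulVec, smul_mulVec, one_mulVec, vecMulVec_mulVec, omegaFlip_mulVec_maxEnt,
      star_maxEnt, hd, dotProduct_add, dotProduct_smul, op_smul_eq_smul, dotProduct_neg] at h1
    simp only [Fintype.card_sum, Fintype.card_fin, smul_eq_mul] at h1
    have h2 : 0 ≤ a * (n + n : ℕ) + b * ((n + n : ℕ) * (n + n : ℕ)) + c * -(n + n : ℕ) := by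
      exact_mod_cast h1
    push_cast at h2
    have hn' : (0 : ℝ) < 2 * n := by positivity
    have h3 : 0 ≤ 2 * n * (a - c + b * (2 * n)) := by linarith
    exact nonneg_of_mul_nonneg_right h3 hn'

end CovMapChoi

/-! ### Separable matrices -/

section Separable

variable {α β : Type*} [Fintype α] [Fintype β]

/-- The product vector `v ⊗ w`. -/
def tensorVec (v : α → ℂ) (w : β → ℂ) : α × β → ℂ := fun p => v p.1 * w p.2

lemma productStates_nonempty [Nonempty α] [Nonempty β] : (productStates α β).Nonempty := by
  classical
  obtain ⟨i⟩ := ‹Nonempty α›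
  obtain ⟨j⟩ := ‹Nonempty β›
  exact ⟨_, Pi.single i 1, Pi.single j 1, by simp, by simp, rfl⟩

open scoped Pointwise in
lemma IsSeparable.add {X Y : Mat (α × β)} (hX : IsSeparable X) (hY : IsSeparable Y) :
    IsSeparable (X + Y) := by
  obtain ⟨a, ρ, ha, hρ, rfl⟩ := hX
  obtain ⟨b, τ, hb, hτ, rfl⟩ := hY
  have h : a • ρ + b • τ ∈ (a + b) • separableStates α β := by
    have hc : Convex ℝ (separableStates α β) := convex_convexHull ℝ _
    rw [hc.add_smul ha hb]
    exact Set.add_mem_add (Set.smul_mem_smul_set hρ) (Set.smul_mem_smul_set hτ)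
  obtain ⟨σ, hσ, e⟩ := h
  exact ⟨a + b, σ, add_nonneg ha hb, hσ, e.symm⟩

lemma IsSeparable.smul {X : Mat (α × β)} (hX : IsSeparable X) {r : ℝ} (hr : 0 ≤ r) :
    IsSeparable (r • X) := by
  obtain ⟨a, ρ, ha, hρ, rfl⟩ := hX
  exact ⟨r * a, ρ, mul_nonneg hr ha, hρ, smul_smul r a ρ⟩

lemma isSeparable_zero [Nonempty α] [Nonempty β] : IsSeparable (0 : Mat (α × β)) := by
  obtain ⟨ρ, hρ⟩ := productStates_nonempty (α := α) (β := β)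
  exact ⟨0, ρ, le_rfl, subset_convexHull ℝ _ hρ, by simp⟩

lemma isSeparable_sum [Nonempty α] [Nonempty β] {ι : Type*} (s : Finset ι) {X : ι → Mat (α × β)}
    (h : ∀ i ∈ s, IsSeparable (X i)) : IsSeparable (∑ i ∈ s, X i) := by
  classical
  induction s using Finset.induction_on with
  | empty => simpa using isSeparable_zero
  | insert i s hi ih =>
    rw [Finset.sum_insert hi]
    exact (h i (Finset.mem_insert_self i s)).add
      (ih fun j hj => h j (Finset.mem_insert_of_mem hj))

lemma exists_eq_smul_unit {v : α → ℂ} (hv : v ≠ 0) :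
    ∃ (r : ℝ) (u : α → ℂ), star u ⬝ᵥ u = 1 ∧ v = r • u := by
  have h0 : 0 < ∑ i, ‖v i‖ ^ 2 := by
    obtain ⟨i, hi⟩ := Function.ne_iff.1 hv
    exact Finset.sum_pos' (fun i _ => by positivity) ⟨i, Finset.mem_univ i, by
      have : 0 < ‖v i‖ := norm_pos_iff.2 hi
      positivity⟩
  set r := √(∑ i, ‖v i‖ ^ 2) with hr
  have hr0 : 0 < r := Real.sqrt_pos.2 h0
  have hr2 : r ^ 2 = ∑ i, ‖v i‖ ^ 2 := Real.sq_sqrt h0.le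
  refine ⟨r, r⁻¹ • v, ?_, by rw [smul_smul, mul_inv_cancel₀ hr0.ne', one_smul]⟩
  have h1 : star v ⬝ᵥ v = ((r ^ 2 : ℝ) : ℂ) := by
    rw [hr2]
    push_cast
    refine Finset.sum_congr rfl fun i _ => ?_
    rw [Pi.star_apply, Complex.star_def, Complex.conj_mul']
  rw [star_smul, smul_dotProduct, dotProduct_smul, h1, star_trivial]
  simp only [Complex.real_smul]
  have : (r : ℂ) ≠ 0 := by exact_mod_cast hr0.ne'
  push_cast
  field_simp

lemma isSeparable_tensorVec [Nonempty α] [Nonempty β] (v : α → ℂ) (w : β → ℂ) :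
    IsSeparable (vecMulVec (tensorVec v w) (star (tensorVec v w))) := by
  by_cases hv : v = 0
  · have : tensorVec v w = 0 := by ext; simp [tensorVec, hv]
    simpa [this] using isSeparable_zero
  by_cases hw : w = 0
  · have : tensorVec v w = 0 := by ext; simp [tensorVec, hw]
    simpa [this] using isSeparable_zero
  obtain ⟨r, u, hu, rfl⟩ := exists_eq_smul_unit hv
  obtain ⟨s, t, ht, rfl⟩ := exists_eq_smul_unit hw
  refine ⟨(r * s) ^ 2, _, sq_nonneg _, subset_convexHull ℝ _ ⟨u, t, hu, ht, rfl⟩, ?_⟩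
  ext p q
  simp [vecMulVec_apply, tensorVec]
  ring

/-- Linear maps commute with convex hulls. Only real linearity is needed. -/
lemma IsSeparable.map {X : Mat (α × β)} (hX : IsSeparable X) (f : Mat (α × β) →ₗ[ℝ] Mat (α × β))
    (hf : ∀ ρ ∈ productStates α β, f ρ ∈ productStates α β) : IsSeparable (f X) := by
  obtain ⟨a, ρ, ha, hρ, rfl⟩ := hX
  refine ⟨a, f ρ, ha, ?_, map_smul f a ρ⟩
  have h := Set.mem_image_of_mem f hρ
  rw [separableStates, f.image_convexHull] at h
  refine convexHull_mono ?_ h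
  rintro _ ⟨σ, hσ, rfl⟩
  exact hf σ hσ

lemma isSeparable_partialTranspose {X : Mat (α × β)} (hX : IsSeparable X) :
    IsSeparable (partialTranspose X) := by
  refine hX.map (f := ⟨⟨partialTranspose, fun _ _ => rfl⟩, fun _ _ => rfl⟩) ?_
  rintro _ ⟨v, w, hv, hw, rfl⟩
  refine ⟨v, star w, hv, ?_, ?_⟩
  · rw [star_star, dotProduct_comm, hw]
  · change partialTranspose _ = _
    ext p q
    simp [partialTranspose, ampliation, transp, vecMulVec_apply]
    ring

lemma isSeparable_conj_kronecker [DecidableEq α] [DecidableEq β] {X : Mat (α × β)}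
    (hX : IsSeparable X) {U : Mat β} (hU : Uᴴ * U = 1) :
    IsSeparable (((1 : Mat α) ⊗ₖ U : Mat (α × β)) * X * ((1 : Mat α) ⊗ₖ U : Mat (α × β))ᴴ) := by
  refine hX.map (f := ⟨⟨fun X => ((1 : Mat α) ⊗ₖ U : Mat (α × β)) * X
    * ((1 : Mat α) ⊗ₖ U : Mat (α × β))ᴴ, fun _ _ => by rw [mul_add, add_mul]⟩,
    fun r X => by simp⟩) ?_
  rintro _ ⟨v, w, hv, hw, rfl⟩
  refine ⟨v, U *ᵥ w, hv, ?_, ?_⟩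
  · rw [star_mulVec, dotProduct_mulVec, vecMul_vecMul, hU, vecMul_one, hw]
  · have h : ((1 : Mat α) ⊗ₖ U : Mat (α × β)) *ᵥ (fun p : α × β => v p.1 * w p.2)
        = fun p => v p.1 * (U *ᵥ w) p.2 := by
      ext p
      simp only [mulVec, dotProduct, kroneckerMap_apply, Fintype.sum_prod_type, Matrix.one_apply]
      rw [Finset.sum_eq_single p.1]
      · rw [Finset.mul_sum]
        refine Finset.sum_congr rfl fun x _ => ?_
        rw [if_pos rfl]
        ring
      · intro b _ hb
        simp [hb.symm]
      · simp
    change ((1 : Mat α) ⊗ₖ U : Mat (α × β)) * vecMulVec _ _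
      * ((1 : Mat α) ⊗ₖ U : Mat (α × β))ᴴ = _
    rw [mul_vecMulVec, vecMulVec_mul, ← star_mulVec, h]

lemma isSeparable_diagonal [DecidableEq α] [DecidableEq β] [Nonempty α] [Nonempty β]
    {r : α × β → ℝ} (hr : ∀ p, 0 ≤ r p) :
    IsSeparable (diagonal fun p => (r p : ℂ)) := by
  have h := isSeparable_sum Finset.univ fun p (_ : p ∈ Finset.univ) =>
    (isSeparable_tensorVec (Pi.single p.1 1 : α → ℂ) (Pi.single p.2 1 : β → ℂ)).smul (hr p)
  convert h using 1
  have e : ∀ p : α × β, tensorVec (Pi.single p.1 (1 : ℂ)) (Pi.single p.2 1) = Pi.single p 1 := by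
    intro p
    ext q
    by_cases h1 : q.1 = p.1 <;> by_cases h2 : q.2 = p.2 <;>
      simp [tensorVec, Pi.single_apply, Prod.ext_iff, h1, h2]
  ext p q
  simp only [e, star_single_one, ← single_eq_single_vecMulVec_single, Matrix.sum_apply,
    Matrix.smul_apply, single_apply, diagonal_apply, Complex.real_smul, mul_ite, mul_one, mul_zero]
  by_cases hpq : p = q
  · subst hpq
    simp
  · rw [if_neg hpq, Finset.sum_eq_zero]
    intro x _
    rw [if_neg (fun h => hpq (h.1.symm.trans h.2))]

/-! ### Averaging product vectors over phases -/

instance fintypeRootsOfUnityFour : Fintype (rootsOfUnity 4 ℂ) := Fintype.ofFinite _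

/-- The imaginary unit as a fourth root of unity. -/
def fourthRootI : rootsOfUnity 4 ℂ :=
  ⟨Units.mk0 Complex.I Complex.I_ne_zero, by
    rw [mem_rootsOfUnity]
    ext
    simp⟩

lemma star_mul_self_rootsOfUnity (z : rootsOfUnity 4 ℂ) :
    star ((z : ℂˣ) : ℂ) * ((z : ℂˣ) : ℂ) = 1 := by
  have h : ((z : ℂˣ) : ℂ) ^ 4 = 1 := by
    rw [← Units.val_pow_eq_pow_val, (mem_rootsOfUnity 4 (z : ℂˣ)).1 z.2, Units.val_one]
  have h1 := Complex.norm_eq_one_of_pow_eq_one h (by norm_num)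
  rw [Complex.star_def, Complex.conj_mul', h1]
  simp

/-- The monomial `x_i x̄_k x̄_j x_l`. -/
def phaseMonomial (i k j l : α) (f : α → rootsOfUnity 4 ℂ) : ℂ :=
  ((f i : ℂˣ) : ℂ) * star ((f k : ℂˣ) : ℂ) * star ((f j : ℂˣ) : ℂ) * ((f l : ℂˣ) : ℂ)

/-- Multiplying one coordinate by I permutes the summands and scales the sum; a coordinate with
scaling factor different from 1 forces the sum to vanish. Signs ±1 would not suffice, since the
unwanted pairing i = l, j = k would survive; with I it picks up I² = -1. -/
lemma sum_phaseMonomial_eq_zero [DecidableEq α] {i k j l : α} (h1 : ¬(i = k ∧ j = l))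
    (h2 : ¬(i = j ∧ k = l)) : ∑ f, phaseMonomial i k j l f = 0 := by
  set c : α → α → ℂ := fun m x => if x = m then Complex.I else 1 with hc
  have key : ∀ m, c m i * star (c m k) * star (c m j) * c m l ≠ 1 →
      ∑ f, phaseMonomial i k j l f = 0 := by
    intro m hm
    set g : α → rootsOfUnity 4 ℂ := Pi.mulSingle m fourthRootI with hg
    have hmul : ∀ (f : α → rootsOfUnity 4 ℂ) (x : α),
        (((f x * g x : rootsOfUnity 4 ℂ) : ℂˣ) : ℂ) = ((f x : ℂˣ) : ℂ) * c m x := by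
      intro f x
      by_cases e : x = m
      · subst e; simp [hg, hc, fourthRootI]
      · simp [hg, hc, e]
    have hs := Equiv.sum_comp (Equiv.mulRight g) (phaseMonomial i k j l)
    have e : ∀ f, phaseMonomial i k j l (Equiv.mulRight g f)
        = (c m i * star (c m k) * star (c m j) * c m l) * phaseMonomial i k j l f := by
      intro f
      simp only [phaseMonomial, Equiv.coe_mulRight, Pi.mul_apply, hmul, star_mul']
      ring
    simp only [e, ← Finset.mul_sum] at hs
    have h3 : (c m i * star (c m k) * star (c m j) * c m l - 1)
        * ∑ f, phaseMonomial i k j l f = 0 := by linear_combination hs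
    exact (mul_eq_zero.1 h3).resolve_left (sub_ne_zero.2 hm)
  have hI : Complex.I ≠ 1 := fun h => by simpa using congrArg Complex.im h
  have hI' : -Complex.I ≠ 1 := fun h => by simpa using congrArg Complex.im h
  by_cases e1 : i = k
  · subst e1
    have e2 : j ≠ l := fun e => h1 ⟨rfl, e⟩
    apply key j
    by_cases e3 : i = j <;> simp [hc, e2.symm, e3, hI']
  by_cases e2 : i = j
  · subst e2
    have e3 : k ≠ l := fun e => h2 ⟨rfl, e⟩
    apply key k
    simp [hc, e3.symm, e1, hI']
  apply key i
  by_cases e3 : l = i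
  · simp [hc, e3, Ne.symm e1, Ne.symm e2]
    norm_num
  · simp [hc, e3, Ne.symm e1, Ne.symm e2, hI]

lemma sum_phaseMonomial [DecidableEq α] (i k j l : α) :
    ∑ f, phaseMonomial i k j l f
      = if (i = k ∧ j = l) ∨ (i = j ∧ k = l)
        then (Fintype.card (α → rootsOfUnity 4 ℂ) : ℂ) else 0 := by
  split_ifs with h
  · have : ∀ f, phaseMonomial i k j l f = 1 := by
      intro f
      have hf := fun x => star_mul_self_rootsOfUnity (f x)
      rcases h with ⟨rfl, rfl⟩ | ⟨rfl, rfl⟩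
      · have h1 := hf i
        have h2 := hf j
        rw [phaseMonomial]
        linear_combination (star ((f j : ℂˣ) : ℂ) * ((f j : ℂˣ) : ℂ)) * h1 + h2
      · have h1 := hf i
        have h2 := hf k
        rw [phaseMonomial]
        linear_combination (star ((f k : ℂˣ) : ℂ) * ((f k : ℂˣ) : ℂ)) * h1 + h2
    simp [this]
  · rw [not_or] at h
    exact sum_phaseMonomial_eq_zero h.1 h.2

/-- The average of the product matrices of `x ⊗ x̄y` over phase vectors `x`. -/
def phaseAverage [DecidableEq α] (y : α → ℂ) : Mat (α × α) :=
  of fun p q => if (p.1 = p.2 ∧ q.1 = q.2) ∨ (p.1 = q.1 ∧ p.2 = q.2)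
    then y p.2 * star (y q.2) else 0

lemma isSeparable_phaseAverage [DecidableEq α] [Nonempty α] (y : α → ℂ) :
    IsSeparable (phaseAverage y) := by
  set N := Fintype.card (α → rootsOfUnity 4 ℂ) with hN
  have hN0 : (N : ℂ) ≠ 0 := by exact_mod_cast Fintype.card_ne_zero
  have h := (isSeparable_sum Finset.univ fun (f : α → rootsOfUnity 4 ℂ) (_ : f ∈ Finset.univ) =>
    isSeparable_tensorVec (fun i => ((f i : ℂˣ) : ℂ))
      (fun k => star ((f k : ℂˣ) : ℂ) * y k)).smul (r := (N : ℝ)⁻¹) (by positivity)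
  convert h using 1
  ext ⟨i, k⟩ ⟨j, l⟩
  have e : ∀ f : α → rootsOfUnity 4 ℂ, vecMulVec
      (tensorVec (fun i => ((f i : ℂˣ) : ℂ)) (fun k => star ((f k : ℂˣ) : ℂ) * y k))
      (star (tensorVec (fun i => ((f i : ℂˣ) : ℂ)) (fun k => star ((f k : ℂˣ) : ℂ) * y k)))
      (i, k) (j, l) = phaseMonomial i k j l f * (y k * star (y l)) := by
    intro f
    simp only [vecMulVec_apply, tensorVec, phaseMonomial, Pi.star_apply, star_mul', star_star]
    ring
  rw [Matrix.smul_apply, Matrix.sum_apply]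
  simp only [e, ← Finset.sum_mul, sum_phaseMonomial, ← hN, phaseAverage, of_apply]
  split_ifs with hc
  · rw [Complex.real_smul]
    push_cast
    field_simp
  · simp

/-- For y = 1 the average already is 1 + P, except that the entries at (i,i),(i,i) are counted once
instead of twice; a diagonal term restores them. -/
lemma isSeparable_one_add_maxEnt [DecidableEq α] [Nonempty α] :
    IsSeparable (1 + vecMulVec (maxEnt α) (star (maxEnt α))) := by
  have h := (isSeparable_phaseAverage (fun _ : α => 1)).add
    (isSeparable_diagonal (r := fun p : α × α => if p.1 = p.2 then 1 else 0)
      (fun p => by split_ifs <;> norm_num))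
  convert h using 1
  ext ⟨i, k⟩ ⟨j, l⟩
  rw [star_maxEnt]
  by_cases h1 : i = j <;> by_cases h2 : k = l <;> by_cases h3 : i = k <;>
    by_cases h4 : j = l <;>
    simp_all [phaseAverage, vecMulVec_apply, maxEnt]

/-- Summing y y* over y = e_k - e_l gives 2(d·1 - J), with J the all-ones matrix. Hence half the sum
of averages has the entries -1 of -P, and d - 1 on the diagonal; a diagonal term supplies the
missing 1 at (i, k) with i ≠ k. -/
lemma isSeparable_card_sub_maxEnt [DecidableEq α] [Nonempty α] :
    IsSeparable ((Fintype.card α : ℂ) • 1 - vecMulVec (maxEnt α) (star (maxEnt α))) := by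
  have h := ((isSeparable_sum Finset.univ fun (x : α × α) (_ : x ∈ Finset.univ) =>
    isSeparable_phaseAverage (Pi.single x.1 1 - Pi.single x.2 1 : α → ℂ)).add
    (isSeparable_diagonal (r := fun p : α × α => if p.1 = p.2 then 0 else 2)
      (fun p => by split_ifs <;> norm_num))).smul (r := 1 / 2) (by norm_num)
  convert h using 1
  have hsum : ∀ k l : α, ∑ x : α × α, (Pi.single x.1 1 - Pi.single x.2 1 : α → ℂ) k
      * star ((Pi.single x.1 1 - Pi.single x.2 1 : α → ℂ) l)
      = (if k = l then 2 * (Fintype.card α : ℂ) else 0) - 2 := by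
    intro k l
    simp only [Pi.sub_apply, Pi.single_apply, star_sub, apply_ite star, star_one, star_zero,
      Fintype.sum_prod_type, mul_sub, Finset.sum_sub_distrib, Finset.sum_ite_eq,
      Finset.mem_univ, if_true, mul_ite, mul_one, mul_zero]
    by_cases e : k = l
    · simp [e]; ring
    · simp [e]; ring
  ext ⟨i, k⟩ ⟨j, l⟩
  rw [star_maxEnt, Matrix.smul_apply, Matrix.add_apply, Matrix.sum_apply]
  simp only [phaseAverage, of_apply]
  by_cases hc : (i = k ∧ j = l) ∨ (i = j ∧ k = l)
  · simp only [hc, if_true, hsum]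
    rcases hc with ⟨rfl, rfl⟩ | ⟨rfl, rfl⟩
    · by_cases e : i = j
      · subst e
        simp [vecMulVec_apply, maxEnt]; ring
      · simp [vecMulVec_apply, maxEnt, e]
    · by_cases e : i = k
      · subst e
        simp [vecMulVec_apply, maxEnt]; ring
      · simp [vecMulVec_apply, maxEnt, e]
  · simp only [hc, if_false]
    rw [not_or] at hc
    have e1 : ¬(i, k) = (j, l) := fun e => hc.2 (Prod.ext_iff.1 e)
    have e2 : maxEnt α (i, k) * maxEnt α (j, l) = 0 := by
      by_cases e3 : i = k
      · have : j ≠ l := fun e => hc.1 ⟨e3, e⟩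
        simp [maxEnt, this]
      · simp [maxEnt, e3]
    simp [vecMulVec_apply, e1, e2]

end Separable

/-! ### Composition, separability and decomposability in terms of (a, b, c) -/

section Composition

variable {n : ℕ}

lemma omegaConj_comp_omegaConj_comp (L : Mat (Fin n ⊕ Fin n) →ₗ[ℂ] Mat (Fin n ⊕ Fin n)) :
    omegaConj n ∘ₗ (omegaConj n ∘ₗ L) = L := by
  ext1 Z
  exact omegaConj_omegaConj (L Z)

lemma omega_mul_neg_omega_mul (Z : Mat (Fin n ⊕ Fin n)) :
    Omega n * (Omega n * Z) = -Z := by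
  rw [← mul_assoc, omega_mul_omega, neg_one_mul]

lemma transp_comp_covMap (a b c : ℝ) :
    transp _ ∘ₗ covMap n a b c = omegaConj n ∘ₗ covMap n a c b := by
  ext1 Z
  change (covMap n a b c Z)ᵀ = Omega n * covMap n a c b Z * (Omega n)ᴴ
  simp only [covMap_apply, omega_conjTranspose, transpose_add, transpose_smul, transpose_mul,
    transpose_neg, transpose_one, transpose_transpose, omega_transpose, mul_add, add_mul,
    Matrix.mul_smul, Matrix.smul_mul, mul_neg, neg_mul, mul_assoc, omega_mul_omega,
    omega_mul_neg_omega_mul, neg_neg, mul_one]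
  module

lemma transp_comp_omegaConj_comp_covMap (a b c : ℝ) :
    transp _ ∘ₗ (omegaConj n ∘ₗ covMap n a b c) = covMap n a c b := by
  ext1 Z
  change (Omega n * covMap n a b c Z * (Omega n)ᴴ)ᵀ = covMap n a c b Z
  simp only [covMap_apply, omega_conjTranspose, transpose_add, transpose_smul, transpose_mul,
    transpose_neg, transpose_one, transpose_transpose, omega_transpose, mul_add, add_mul,
    Matrix.mul_smul, Matrix.smul_mul, mul_neg, neg_mul, mul_assoc, omega_mul_omega,
    omega_mul_neg_omega_mul, neg_neg, mul_one]
  module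

lemma trace_omega_conj (Z : Mat (Fin n ⊕ Fin n)) : (Omega n * (Z * Omega n)).trace = -Z.trace := by
  rw [trace_mul_comm, mul_assoc, omega_mul_omega, mul_neg, mul_one, trace_neg]

lemma covMap_comp_omegaConj (a b c : ℝ) :
    covMap n a b c ∘ₗ omegaConj n = omegaConj n ∘ₗ covMap n a b c := by
  ext1 Z
  change covMap n a b c (Omega n * Z * (Omega n)ᴴ) = Omega n * covMap n a b c Z * (Omega n)ᴴ
  simp only [covMap_apply, omega_conjTranspose, transpose_mul,
    transpose_neg, omega_transpose, mul_add, add_mul,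
    Matrix.mul_smul, Matrix.smul_mul, mul_neg, neg_mul, mul_assoc, omega_mul_omega,
    omega_mul_neg_omega_mul, neg_neg, mul_one, trace_neg, trace_omega_conj]
  module

lemma covMap_comp_covMap (a₁ b₁ c₁ a₂ b₂ c₂ : ℝ) :
    covMap n a₁ b₁ c₁ ∘ₗ covMap n a₂ b₂ c₂
      = covMap n (2 * n * a₁ * a₂ + a₁ * (b₂ + c₂) + a₂ * (b₁ + c₁)) (b₁ * b₂ + c₁ * c₂)
        (b₁ * c₂ + c₁ * b₂) := by
  ext1 Z
  change covMap n a₁ b₁ c₁ (covMap n a₂ b₂ c₂ Z) = _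
  simp only [covMap_apply, omega_conjTranspose, transpose_mul, transpose_add, transpose_smul,
    transpose_neg, transpose_one, transpose_transpose, omega_transpose, mul_add, add_mul,
    Matrix.mul_smul, Matrix.smul_mul, mul_neg, neg_mul, mul_assoc, omega_mul_omega,
    omega_mul_neg_omega_mul, neg_neg, mul_one, trace_neg, trace_add, trace_smul, trace_omega_conj,
    trace_transpose, trace_one, smul_eq_mul, Fintype.card_sum, Fintype.card_fin]
  push_cast
  module

/-- The maps `covMap` and their conjugates by `Ω`: the covariant Hermitian-preserving maps. -/
def IsCovForm (a b c : ℝ) (L : Mat (Fin n ⊕ Fin n) →ₗ[ℂ] Mat (Fin n ⊕ Fin n)) : Prop :=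
  L = covMap n a b c ∨ L = omegaConj n ∘ₗ covMap n a b c

lemma exists_isCovForm (hn : 2 ≤ n) {L : Mat (Fin n ⊕ Fin n) →ₗ[ℂ] Mat (Fin n ⊕ Fin n)}
    (hcov : IsCovSS L ∨ IsCovSSbar L) (hH : IsHermitianPreserving L) :
    ∃ a b c : ℝ, IsCovForm a b c L := by
  rcases hcov with h | h
  · obtain ⟨a, b, c, e⟩ := exists_eq_covMap hn h hH
    exact ⟨a, b, c, Or.inl e⟩
  · obtain ⟨a, b, c, e⟩ := exists_eq_omegaConj_covMap hn h hH
    exact ⟨a, b, c, Or.inr e⟩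

variable {L L₁ L₂ : Mat (Fin n ⊕ Fin n) →ₗ[ℂ] Mat (Fin n ⊕ Fin n)}

lemma IsCovForm.omegaConj {a b c : ℝ} (h : IsCovForm a b c L) :
    IsCovForm a b c (omegaConj n ∘ₗ L) := by
  rcases h with rfl | rfl
  · exact Or.inr rfl
  · exact Or.inl (omegaConj_comp_omegaConj_comp _)

lemma IsCovForm.transp {a b c : ℝ} (h : IsCovForm a b c L) :
    IsCovForm a c b (transp _ ∘ₗ L) := by
  rcases h with rfl | rfl
  · exact Or.inr (transp_comp_covMap a b c)
  · exact Or.inl (transp_comp_omegaConj_comp_covMap a b c)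

lemma IsCovForm.comp {a₁ b₁ c₁ a₂ b₂ c₂ : ℝ} (h₁ : IsCovForm a₁ b₁ c₁ L₁)
    (h₂ : IsCovForm a₂ b₂ c₂ L₂) :
    IsCovForm (2 * n * a₁ * a₂ + a₁ * (b₂ + c₂) + a₂ * (b₁ + c₁)) (b₁ * b₂ + c₁ * c₂)
      (b₁ * c₂ + c₁ * b₂) (L₁ ∘ₗ L₂) := by
  have h0 : ∀ {M}, IsCovForm a₂ b₂ c₂ M →
      IsCovForm (2 * n * a₁ * a₂ + a₁ * (b₂ + c₂) + a₂ * (b₁ + c₁)) (b₁ * b₂ + c₁ * c₂)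
      (b₁ * c₂ + c₁ * b₂) (covMap n a₁ b₁ c₁ ∘ₗ M) := by
    rintro M (rfl | rfl)
    · exact Or.inl (covMap_comp_covMap _ _ _ _ _ _)
    · right
      rw [← LinearMap.comp_assoc, covMap_comp_omegaConj, LinearMap.comp_assoc, covMap_comp_covMap]
  rcases h₁ with rfl | rfl
  · exact h0 h₂
  · rw [LinearMap.comp_assoc]
    exact (h0 h₂).omegaConj

lemma IsCovForm.isCP_iff (hn : 2 ≤ n) {a b c : ℝ} (h : IsCovForm a b c L) :
    IsCP L ↔ 0 ≤ a + c ∧ 0 ≤ a - c ∧ 0 ≤ a - c + b * (2 * n) := by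
  have : Nonempty (Fin n ⊕ Fin n) := ⟨Sum.inl ⟨0, by omega⟩⟩
  have h0 : IsCP (covMap n a b c) ↔ 0 ≤ a + c ∧ 0 ≤ a - c ∧ 0 ≤ a - c + b * (2 * n) :=
    ⟨le_of_isCP_covMap hn, fun h => isCP_covMap_of_le (by omega) h.1 h.2.1 h.2.2⟩
  rw [← h0]
  rcases h with rfl | rfl
  · rfl
  · refine ⟨fun h => ?_, isCP_omegaConj_comp⟩
    rw [← omegaConj_comp_omegaConj_comp (covMap n a b c)]
    exact isCP_omegaConj_comp h

lemma IsCovForm.isCoCP_iff (hn : 2 ≤ n) {a b c : ℝ} (h : IsCovForm a b c L) :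
    IsCoCP L ↔ 0 ≤ a + b ∧ 0 ≤ a - b ∧ 0 ≤ a - b + c * (2 * n) :=
  h.transp.isCP_iff hn

/-- The three diagonal values of the image of E_ii; only these necessary conditions for positivity
are needed later. -/
lemma IsCovForm.le_of_isPositiveMap (hn : 2 ≤ n) {a b c : ℝ} (h : IsCovForm a b c L)
    (hL : IsPositiveMap L) : 0 ≤ a ∧ 0 ≤ a + b ∧ 0 ≤ a + c := by
  have h0 : IsPositiveMap (covMap n a b c) := by
    rcases h with rfl | rfl
    · exact hL
    · intro Z hZ
      have h1 := (hL Z hZ).mul_mul_conjTranspose_same (Omega n)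
      have h2 := omegaConj_omegaConj (covMap n a b c Z)
      rw [omegaConj_apply] at h2
      rwa [LinearMap.comp_apply, h2] at h1
  set i : Fin n ⊕ Fin n := Sum.inl ⟨0, by omega⟩ with hi
  set k : Fin n ⊕ Fin n := Sum.inl ⟨1, by omega⟩ with hk
  have hik : i ≠ k := by simp [hi, hk]
  have hik' : i.swap ≠ k := by simp [hi, hk]
  have hP : (single i i (1 : ℂ)).PosSemidef := by
    rw [single_eq_single_vecMulVec_single]
    conv => enter [1, 2]; rw [← star_single_one]
    exact posSemidef_vecMulVec_self_star _
  have h1 := fun m => (h0 _ hP).diag_nonneg (i := m)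
  simp only [covMap_apply, omega_single_omega] at h1
  have e1 := h1 i
  have e2 := h1 i.swap
  have e3 := h1 k
  simp [swap_ne] at e1
  simp [(swap_ne i).symm] at e2
  simp [hik, hik'] at e3
  exact ⟨by exact_mod_cast e3, by exact_mod_cast e1, by exact_mod_cast e2⟩

lemma covMap_add (a b c a' b' c' : ℝ) :
    covMap n (a + a') (b + b') (c + c') = covMap n a b c + covMap n a' b' c' := by
  ext1 Z
  simp only [LinearMap.add_apply, covMap_apply]
  push_cast
  module

theorem IsCovForm.isDecomposable (hn : 2 ≤ n) {a b c a' b' c' : ℝ}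
    (h : IsCovForm (a + a') (b + b') (c + c') L)
    (h1 : 0 ≤ a + c ∧ 0 ≤ a - c ∧ 0 ≤ a - c + b * (2 * n))
    (h2 : 0 ≤ a' + b' ∧ 0 ≤ a' - b' ∧ 0 ≤ a' - b' + c' * (2 * n)) : IsDecomposable L := by
  rcases h with rfl | rfl
  · exact ⟨covMap n a b c, covMap n a' b' c', (IsCovForm.isCP_iff hn (Or.inl rfl)).2 h1,
      (IsCovForm.isCoCP_iff hn (Or.inl rfl)).2 h2, covMap_add _ _ _ _ _ _⟩
  · exact ⟨SympPPT.omegaConj n ∘ₗ covMap n a b c, SympPPT.omegaConj n ∘ₗ covMap n a' b' c',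
      (IsCovForm.isCP_iff hn (Or.inr rfl)).2 h1,
      (IsCovForm.isCoCP_iff hn (Or.inr rfl)).2 h2, by rw [covMap_add, LinearMap.comp_add]⟩

lemma isSeparable_rawChoi_omegaConj (h : IsSeparable (rawChoi L)) :
    IsSeparable (rawChoi (omegaConj n ∘ₗ L)) := by
  rw [rawChoi_omegaConj_comp]
  apply isSeparable_conj_kronecker h
  rw [omega_conjTranspose, neg_mul, omega_mul_omega, neg_neg]

lemma isSeparable_rawChoi_transp (h : IsSeparable (rawChoi L)) :
    IsSeparable (rawChoi (transp _ ∘ₗ L)) :=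
  isSeparable_partialTranspose h

/-- Partial transposition swaps b and c up to a local Ω on the second factor, and both operations
preserve separability. -/
lemma isSeparable_rawChoi_covMap_comm {a b c : ℝ} (h : IsSeparable (rawChoi (covMap n a b c))) :
    IsSeparable (rawChoi (covMap n a c b)) := by
  have h1 := isSeparable_rawChoi_omegaConj (isSeparable_rawChoi_transp h)
  rwa [transp_comp_covMap, omegaConj_comp_omegaConj_comp] at h1

lemma isSeparable_rawChoi_covMap_add {a b c a' b' c' r r' : ℝ} (hr : 0 ≤ r) (hr' : 0 ≤ r')
    (h : IsSeparable (rawChoi (covMap n a b c))) (h' : IsSeparable (rawChoi (covMap n a' b' c'))) :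
    IsSeparable (rawChoi (covMap n (r * a + r' * a') (r * b + r' * b') (r * c + r' * c'))) := by
  convert (h.smul hr).add (h'.smul hr') using 1
  simp only [rawChoi_covMap, ← Complex.coe_smul]
  push_cast
  module

/-- Together the bounds say a ≥ max(b, -db) + max(c, -dc). The terms in b and c are thus paid for by
|b| times (1,1,0) or (d,-1,0) and |c| times (1,0,1) or (d,0,-1), and the surplus in a is a multiple
of the identity. -/
theorem isSeparable_rawChoi_covMap (hn : 1 ≤ n) {a b c : ℝ} (h1 : b + c ≤ a)
    (h2 : b - 2 * n * c ≤ a) (h3 : c - 2 * n * b ≤ a) (h4 : -(2 * n * b) - 2 * n * c ≤ a) :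
    IsSeparable (rawChoi (covMap n a b c)) := by
  have : Nonempty (Fin n ⊕ Fin n) := ⟨Sum.inl ⟨0, by omega⟩⟩
  have s0 : IsSeparable (rawChoi (covMap n 1 0 0)) := by
    have h := isSeparable_diagonal (α := Fin n ⊕ Fin n) (β := Fin n ⊕ Fin n) (r := fun _ => 1)
      (fun _ => zero_le_one)
    convert h using 1
    rw [rawChoi_covMap]
    simp
  have s1 : IsSeparable (rawChoi (covMap n 1 1 0)) := by
    convert isSeparable_one_add_maxEnt (α := Fin n ⊕ Fin n) using 1
    rw [rawChoi_covMap]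
    simp
  have s2 : IsSeparable (rawChoi (covMap n (2 * n) (-1) 0)) := by
    convert isSeparable_card_sub_maxEnt (α := Fin n ⊕ Fin n) using 1
    rw [rawChoi_covMap]
    simp only [Fintype.card_sum, Fintype.card_fin]
    push_cast
    module
  have s3 := isSeparable_rawChoi_covMap_comm s1
  have s4 := isSeparable_rawChoi_covMap_comm s2
  have combine : ∀ u v : ℝ, 0 ≤ |b| → |b| * u + |c| * v ≤ a →
      ∀ e f : ℝ, |b| * e = b → |c| * f = c → IsSeparable (rawChoi (covMap n u e 0)) →
      IsSeparable (rawChoi (covMap n v 0 f)) → IsSeparable (rawChoi (covMap n a b c)) := by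
    intro u v hb huv e f he hf hu hv
    have := isSeparable_rawChoi_covMap_add (sub_nonneg.2 huv) zero_le_one s0
      (isSeparable_rawChoi_covMap_add hb (abs_nonneg c) hu hv)
    convert this using 3
    · ring
    · linarith
    · linarith
  rcases le_total 0 b with hb | hb <;> rcases le_total 0 c with hc | hc
  · refine combine 1 1 (abs_nonneg b) ?_ 1 1 ?_ ?_ s1 s3 <;>
      simp only [abs_of_nonneg hb, abs_of_nonneg hc] <;> linarith
  · refine combine 1 (2 * n) (abs_nonneg b) ?_ 1 (-1) ?_ ?_ s1 s4 <;>
      simp only [abs_of_nonneg hb, abs_of_nonpos hc] <;> linarith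
  · refine combine (2 * n) 1 (abs_nonneg b) ?_ (-1) 1 ?_ ?_ s2 s3 <;>
      simp only [abs_of_nonpos hb, abs_of_nonneg hc] <;> linarith
  · refine combine (2 * n) (2 * n) (abs_nonneg b) ?_ (-1) (-1) ?_ ?_ s2 s4 <;>
      simp only [abs_of_nonpos hb, abs_of_nonpos hc] <;> linarith

theorem IsCovForm.isEntanglementBreaking (hn : 1 ≤ n) {a b c : ℝ} (h : IsCovForm a b c L)
    (h1 : b + c ≤ a) (h2 : b - 2 * n * c ≤ a) (h3 : c - 2 * n * b ≤ a)
    (h4 : -(2 * n * b) - 2 * n * c ≤ a) : IsEntanglementBreaking L := by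
  have h0 := isSeparable_rawChoi_covMap hn h1 h2 h3 h4
  have h5 : IsSeparable (rawChoi L) := by
    rcases h with rfl | rfl
    · exact h0
    · exact isSeparable_rawChoi_omegaConj h0
  have h6 := h5.smul (r := 1 / (Fintype.card (Fin n ⊕ Fin n) : ℝ)) (by positivity)
  rw [← Complex.coe_smul] at h6
  rw [IsEntanglementBreaking, choi_eq]
  push_cast at h6 ⊢
  exact h6

/-- The cone of parameters of the PPT maps, for `d ≥ 4`. -/
def PPTCone (d a b c : ℝ) : Prop :=
  b ≤ a ∧ c ≤ a ∧ 0 ≤ a - c + b * d ∧ 0 ≤ a - b + c * d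

/-- The plane b = c cuts the cone into two simplicial cones with common rays (1,1,1), (d-1,-1,-1)
and third ray (1,1,0) or (1,0,1); x, z, y are the coordinates along them. -/
lemma PPTCone.exists_eq {d a b c : ℝ} (hd : 4 ≤ d) (h : PPTCone d a b c) :
    ∃ x y z : ℝ, 0 ≤ x ∧ 0 ≤ y ∧ 0 ≤ z ∧ a = x + y + (d - 1) * z ∧
      ((b = x + y - z ∧ c = x - z) ∨ (b = x - z ∧ c = x + y - z)) := by
  obtain ⟨h1, h2, h3, h4⟩ := h
  have hd0 : 0 < d := by linarith
  rcases le_total c b with hcb | hcb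
  · refine ⟨(c * d + a - b) / d, b - c, (a - b) / d, div_nonneg (by linarith) hd0.le,
      by linarith, div_nonneg (by linarith) hd0.le, ?_, Or.inl ⟨?_, ?_⟩⟩ <;> field_simp <;> ring
  · refine ⟨(b * d + a - c) / d, c - b, (a - c) / d, div_nonneg (by linarith) hd0.le,
      by linarith, div_nonneg (by linarith) hd0.le, ?_, Or.inr ⟨?_, ?_⟩⟩ <;> field_simp <;> ring

lemma PPTCone.comp {d a₁ b₁ c₁ a₂ b₂ c₂ a b c : ℝ} (hd : 4 ≤ d) (h₁ : PPTCone d a₁ b₁ c₁)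
    (h₂ : PPTCone d a₂ b₂ c₂) (ha : a = d * a₁ * a₂ + a₁ * (b₂ + c₂) + a₂ * (b₁ + c₁))
    (hb : b = b₁ * b₂ + c₁ * c₂) (hc : c = b₁ * c₂ + c₁ * b₂) :
    b + c ≤ a ∧ b - d * c ≤ a ∧ c - d * b ≤ a ∧ -(d * b) - d * c ≤ a := by
  obtain ⟨x, y, z, hx, hy, hz, rfl, h1⟩ := h₁.exists_eq hd
  obtain ⟨u, v, w, hu, hv, hw, rfl, h2⟩ := h₂.exists_eq hd
  -- In terms of e = d - 4 and the ray coordinates, each difference expands to a polynomial with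
  -- nonnegative coefficients.
  obtain ⟨e, rfl⟩ : ∃ e, d = e + 4 := ⟨d - 4, by ring⟩
  have he : 0 ≤ e := by linarith
  rcases h1 with ⟨rfl, rfl⟩ | ⟨rfl, rfl⟩ <;> rcases h2 with ⟨rfl, rfl⟩ | ⟨rfl, rfl⟩ <;>
    subst ha hb hc <;> refine ⟨?_, ?_, ?_, ?_⟩ <;> rw [← sub_nonneg] <;> ring_nf <;> positivity

lemma IsCovForm.pptCone (hn : 2 ≤ n) {a b c : ℝ} (h : IsCovForm a b c L) (hL : IsPPTMap L) :
    PPTCone (2 * n) a b c := by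
  have : Nonempty (Fin n ⊕ Fin n) := ⟨Sum.inl ⟨0, by omega⟩⟩
  have h1 := (h.isCP_iff hn).1 hL.1
  have h2 := (h.isCoCP_iff hn).1 hL.isCoCP
  exact ⟨by linarith, by linarith, h1.2.2, h2.2.2⟩

theorem isEntanglementBreaking_comp (hn : 2 ≤ n) {a₁ b₁ c₁ a₂ b₂ c₂ : ℝ}
    (h₁ : IsCovForm a₁ b₁ c₁ L₁) (h₂ : IsCovForm a₂ b₂ c₂ L₂) (hL₁ : IsPPTMap L₁)
    (hL₂ : IsPPTMap L₂) : IsEntanglementBreaking (L₁ ∘ₗ L₂) := by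
  have hd : (4 : ℝ) ≤ 2 * n := by
    have : (2 : ℝ) ≤ n := by exact_mod_cast hn
    linarith
  obtain ⟨e1, e2, e3, e4⟩ := PPTCone.comp hd (h₁.pptCone hn hL₁) (h₂.pptCone hn hL₂) rfl rfl rfl
  exact (h₁.comp h₂).isEntanglementBreaking (by omega) e1 e2 e3 e4

lemma IsCovForm.isDecomposable_of_positive_ppt (hn : 2 ≤ n) {a₁ b₁ c₁ a₂ b₂ c₂ : ℝ}
    (h₁ : 0 ≤ a₁ ∧ 0 ≤ a₁ + b₁ ∧ 0 ≤ a₁ + c₁) (h₂ : PPTCone (2 * n) a₂ b₂ c₂)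
    (h : IsCovForm (2 * n * a₁ * a₂ + a₁ * (b₂ + c₂) + a₂ * (b₁ + c₁)) (b₁ * b₂ + c₁ * c₂)
      (b₁ * c₂ + c₁ * b₂) L) : IsDecomposable L := by
  have hd : (4 : ℝ) ≤ 2 * n := by
    have : (2 : ℝ) ≤ n := by exact_mod_cast hn
    linarith
  obtain ⟨hr, hp, hq⟩ := h₁
  obtain ⟨x, y, z, hx, hy, hz, ha, hbc⟩ := h₂.exists_eq hd
  obtain ⟨f1, f2, f3, f4⟩ := h₂
  have hs : b₂ + c₂ = 2 * x + y - 2 * z := by rcases hbc with ⟨e, e'⟩ | ⟨e, e'⟩ <;> linarith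
  have hdy := mul_nonneg (sub_nonneg.2 hd) hy
  have hdz := mul_nonneg (sub_nonneg.2 hd) hz
  have hdx := mul_nonneg (sub_nonneg.2 hd) hx
  have hddz := mul_nonneg (sub_nonneg.2 hd) hdz
  have f5 : 0 ≤ a₂ + b₂ := by rcases hbc with ⟨e, e'⟩ | ⟨e, e'⟩ <;> rw [ha, e] <;> linarith
  have f6 : 0 ≤ a₂ + c₂ := by rcases hbc with ⟨e, e'⟩ | ⟨e, e'⟩ <;> rw [ha, e'] <;> linarith
  set s := b₂ + c₂ with hsd
  -- The map (1,-1,-1) composed with (a₂, b₂, c₂) has parameters (2t, -s, -s).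
  set t := (a₂ * (2 * n - 2) + s) / 2 with ht
  -- It splits into a CP part (t, -s/4, -3s/4) and a completely copositive part (t, -3s/4, -s/4),
  -- exchanged by swapping b and c, so one set of inequalities serves both. On the ray (1,1,1), a
  -- weight λ in place of 1/4 must satisfy λ ≤ (d+4)/(4(d+1)), a bound that exceeds 1/4 for every d
  -- and tends to it.
  have g1 : 0 ≤ t + -(3 / 4) * s := by rw [ht, hs, ha]; nlinarith
  have g2 : 0 ≤ t - -(3 / 4) * s := by rw [ht, hs, ha]; nlinarith
  have g3 : 0 ≤ t - -(3 / 4) * s + -(1 / 4) * s * (2 * n) := by rw [ht, hs, ha]; nlinarith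
  have k1 := mul_nonneg hr g1
  have k2 := mul_nonneg hr g2
  have k3 := mul_nonneg hr g3
  -- The multiple a₁ + b₁ of (a₂, b₂, c₂) joins the CP part, and the multiple a₁ + c₁ of the swapped
  -- triple (a₂, c₂, b₂) the completely copositive part.
  refine IsCovForm.isDecomposable hn (a := (a₁ + b₁) * a₂ + a₁ * t)
    (b := (a₁ + b₁) * b₂ + a₁ * (-(1 / 4) * s)) (c := (a₁ + b₁) * c₂ + a₁ * (-(3 / 4) * s))
    (a' := (a₁ + c₁) * a₂ + a₁ * t) (b' := (a₁ + c₁) * c₂ + a₁ * (-(3 / 4) * s))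
    (c' := (a₁ + c₁) * b₂ + a₁ * (-(1 / 4) * s)) ?_ ⟨?_, ?_, ?_⟩ ⟨?_, ?_, ?_⟩
  · convert h using 1 <;> simp only [ht, hsd] <;> ring
  · linarith [mul_nonneg hp f6]
  · linarith [mul_nonneg hp (sub_nonneg.2 f2)]
  · linarith [mul_nonneg hp f3]
  · linarith [mul_nonneg hq f6]
  · linarith [mul_nonneg hq (sub_nonneg.2 f2)]
  · linarith [mul_nonneg hq f3]

end Composition

end SympPPT

end

theorem mainTheorem8 (n : ℕ) (hn : 2 ≤ n)
    (L₁ L₂ : SympPPT.Mat (Fin n ⊕ Fin n) →ₗ[ℂ] SympPPT.Mat (Fin n ⊕ Fin n))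
    (hL₁ : SympPPT.IsHermitianPreserving L₁) (hL₂ : SympPPT.IsHermitianPreserving L₂)
    (hcov₁ : SympPPT.IsCovSS L₁ ∨ SympPPT.IsCovSSbar L₁)
    (hcov₂ : SympPPT.IsCovSS L₂ ∨ SympPPT.IsCovSSbar L₂) :
    (SympPPT.IsPPTMap L₁ → SympPPT.IsPPTMap L₂ →
      SympPPT.IsEntanglementBreaking (L₁ ∘ₗ L₂)) ∧
    (SympPPT.IsPositiveMap L₁ → SympPPT.IsPPTMap L₂ →
      SympPPT.IsDecomposable (L₁ ∘ₗ L₂) ∧ SympPPT.IsDecomposable (L₂ ∘ₗ L₁)) := by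
  obtain ⟨a₁, b₁, c₁, h₁⟩ := SympPPT.exists_isCovForm hn hcov₁ hL₁
  obtain ⟨a₂, b₂, c₂, h₂⟩ := SympPPT.exists_isCovForm hn hcov₂ hL₂
  refine ⟨SympPPT.isEntanglementBreaking_comp hn h₁ h₂, fun hp hppt => ?_⟩
  have k₁ := h₁.le_of_isPositiveMap hn hp
  have k₂ := h₂.pptCone hn hppt
  refine ⟨(h₁.comp h₂).isDecomposable_of_positive_ppt hn k₁ k₂, ?_⟩
  -- The composition formula is symmetric in the two triples, so the reversed composition has the
  -- same parameters.
  have h₃ := h₂.comp h₁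
  refine SympPPT.IsCovForm.isDecomposable_of_positive_ppt hn k₁ k₂ ?_
  convert h₃ using 1 <;> ring
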